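/- Let $A\in\mathbb R^{n\times n}$ be symmetric with zero diagonal and $\theta\in\mathbb R^n$. The Ising model $\mathcal D(A,\theta)$ is the distribution on $\{-1,1\}^n$ with $$\Pr[Z=z]\propto\exp\Big(\sum_{i<j}A_{ij}z_iz_j+\sum_i\theta_iz_i\Big),$$ and its width is $\lambda(A,\theta)=\max_i\big(\sum_j|A_{ij}|+|\theta_i|\big)$. **Algorithm.** The input is a sequence of samples $z^1,\dots,z^N\in\{-1,1\}^n$, a bound $\lambda$, a number $\eta$ and a number of iterations $T$. For each node $i\in[n]$, put $x^m=[z^m_{-i},1]\in\{-1,1\}^n$ and $y^m=z^m_i$, and run $T$ iterations of entropic mirror descent for $$\min_{w\in\mathbb R^n}\frac1N\sum_{m=1}^N\ln\big(1+e^{-y^m\langle w,x^m\rangle}\big)\quad\text{subject to }\|w\|_1\le W:=2\lambda,$$ as follows. Let $\hat x^m=W\cdot[x^m,-x^m,0]\in\mathbb R^{2n+1}$, $\hat y^m=(y^m+1)/2$, $\gamma=\frac1{2W}\sqrt{2\ln(2n+1)/T}$, and let $w^1\in\mathbb R^{2n+1}$ be the uniform probability vector. For $t=1,\dots,T$ let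 $$g^t=\frac1N\sum_{m=1}^N\big(\sigma(\langle w^t,\hat x^m\rangle)-\hat y^m\big)\hat x^m,\qquad \sigma(u)=\frac1{1+e^{-u}},$$ and obtain $w^{t+1}$ by dividing the vector $\big(w^t_ce^{-\gamma g^t_c}\big)_{c\in[2n+1]}$ by its $\ell_1$ norm. With $\bar w=\frac1T\sum_{t=1}^Tw^t$, the solution is $W(\bar w_{1:n}-\bar w_{(n+1):2n})\in\mathbb R^n$. Half of its coordinate belonging to node $j\ne i$ is $\hat A_{ij}$, and $\hat A_{ii}=0$. The output is $\hat A$ and the graph $\hat G$ on $[n]$ with edges $\{(i,j):i<j,\ |\hat A_{ij}|\ge\eta/2\}$. **Theorem.** There is a universal constant $C>0$ such that the following holds. 1. Let $\lambda(A,\theta)\le\lambda$, $\rho\in(0,1)$ and $\epsilon>0$. If $$T\ge C\,\frac{\lambda^2e^{12\lambda}\ln n}{\epsilon^4}\qquad\text{and}\qquad N\ge C\,\frac{\lambda^2e^{12\lambda}\ln(n/\rho)}{\epsilon^4},$$ then with probability at least $1-\rho$ over $N$ i.i.d. samples from $\mathcal D(A,\theta)$, the output of the algorithm satisfies $\max_{i,j\in[n]}|A_{ij}-\hat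 A_{ij}|\le\epsilon$. 2. Count every arithmetic operation, evaluation of $\exp$, $\ln$, $\sqrt{\cdot}$ or $|\cdot|$, comparison, memory access and loop iteration as a constant number of steps (real RAM). The direct implementation of the algorithm as one fixed program outputs $\hat A$ and $\hat G$, and for $n,N,T\ge1$ it takes $O(TNn^2)$ steps, with a universal constant. In particular, for fixed $\lambda>0$, $\rho\in(0,1)$ and $\epsilon>0$, and with $T$ and $N$ equal to the bounds in part 1 rounded up, it takes $O(n^2(\ln n)^2)=\tilde O(n^2)$ steps for $n\ge2$. -/

import Mathlib

open MeasureTheory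

noncomputable section

/-! ### The Ising model on `{-1, 1}ⁿ` (spins are elements of `ℤˣ = {1, -1}`) -/

/-- The value of a spin as a real number, `1` or `-1`. -/
def spin (s : ℤˣ) : ℝ := ((s : ℤ) : ℝ)

/-- Every set of spins is measurable. -/
instance : DiscreteMeasurableSpace ℤˣ where
  forall_measurableSet s :=
    ⟨(fun u : ℤˣ => (u : ℤ)) '' s, MeasurableSet.of_discrete,
      Set.preimage_image_eq s Units.val_injective⟩

/-- `exp (∑_{i<j} A i j z i z j + ∑ i, θ i z i)`. -/
def isingWeight {n : ℕ} (A : Matrix (Fin n) (Fin n) ℝ) (θ : Fin n → ℝ)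
    (z : Fin n → ℤˣ) : ℝ :=
  Real.exp ((∑ i, ∑ j ∈ Finset.Ioi i, A i j * spin (z i) * spin (z j))
    + ∑ i, θ i * spin (z i))

/-- The Ising model distribution `D(A, θ)`: probability proportional to `isingWeight`. -/
def isingPMF {n : ℕ} (A : Matrix (Fin n) (Fin n) ℝ) (θ : Fin n → ℝ) :
    PMF (Fin n → ℤˣ) :=
  PMF.ofFintype
    (fun z => ENNReal.ofReal (isingWeight A θ z / ∑ z', isingWeight A θ z'))
    (by
      have hpos : ∀ z, 0 < isingWeight A θ z := fun z => Real.exp_pos _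
      have hZ : 0 < ∑ z', isingWeight A θ z' :=
        Finset.sum_pos (fun z _ => hpos z) Finset.univ_nonempty
      rw [← ENNReal.ofReal_sum_of_nonneg (fun z _ => (div_pos (hpos z) hZ).le),
        ← Finset.sum_div, div_self hZ.ne', ENNReal.ofReal_one])

/-- The law of `N` i.i.d. samples from `D(A, θ)`. -/
def isingSamples {n : ℕ} (A : Matrix (Fin n) (Fin n) ℝ) (θ : Fin n → ℝ) (N : ℕ) :
    Measure (Fin N → Fin n → ℤˣ) :=
  Measure.pi fun _ => (isingPMF A θ).toMeasure

/-- The width `max_i (∑ j, |A i j| + |θ i|)`. -/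
def isingWidth {n : ℕ} (A : Matrix (Fin n) (Fin n) ℝ) (θ : Fin n → ℝ) : ℝ :=
  ⨆ i, ((∑ j, |A i j|) + |θ i|)

/-! ### Entropic mirror descent for `ℓ₁`-constrained logistic regression -/

/-- The `2n+1` coordinates of the lifted problem: `[x, -x, 0]`. -/
abbrev LiftedCoord (n : ℕ) : Type := (Fin n ⊕ Fin n) ⊕ Unit

/-- The lifted sample `[x, -x, 0] * W`. -/
def liftSample {n : ℕ} (W : ℝ) (x : Fin n → ℝ) : LiftedCoord n → ℝ :=
  Sum.elim (Sum.elim (fun j => x j * W) (fun j => -x j * W)) (fun _ => 0)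

/-- The gradient `(1/N) ∑ m, (σ(⟨w, x̂ m⟩) - ŷ m) x̂ m` with `x̂` the lifted samples and
`ŷ m = (y m + 1) / 2`. -/
def mdGradient {n N : ℕ} (W : ℝ) (x : Fin N → Fin n → ℝ) (y : Fin N → ℝ)
    (w : LiftedCoord n → ℝ) : LiftedCoord n → ℝ := fun c =>
  (1 / (N : ℝ)) * ∑ m, (Real.sigmoid (∑ c', w c' * liftSample W (x m) c') - (y m + 1) / 2)
    * liftSample W (x m) c

/-- The step size `(1 / (2W)) √(2 ln(2n+1) / T)`. -/
def mdStepSize (n : ℕ) (W : ℝ) (T : ℕ) : ℝ :=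
  1 / (2 * W) * √(2 * Real.log (2 * n + 1) / T)

/-- One update: multiply coordinatewise by `exp (-γ g)`, then divide by the `ℓ₁` norm. -/
def mdUpdate {n : ℕ} (γ : ℝ) (g w : LiftedCoord n → ℝ) : LiftedCoord n → ℝ := fun c =>
  w c * Real.exp (-γ * g c) / ∑ c', |w c' * Real.exp (-γ * g c')|

/-- The iterates; `mdIterate W T x y t` is the `(t+1)`-st one, the first is uniform. -/
def mdIterate {n N : ℕ} (W : ℝ) (T : ℕ) (x : Fin N → Fin n → ℝ) (y : Fin N → ℝ) :
    ℕ → LiftedCoord n → ℝ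
  | 0 => fun _ => 1 / (2 * n + 1)
  | t + 1 => mdUpdate (mdStepSize n W T)
      (mdGradient W x y (mdIterate W T x y t)) (mdIterate W T x y t)

/-- The average of the first `T` iterates. -/
def mdAverage {n N : ℕ} (W : ℝ) (T : ℕ) (x : Fin N → Fin n → ℝ) (y : Fin N → ℝ) :
    LiftedCoord n → ℝ := fun c =>
  (∑ t ∈ Finset.range T, mdIterate W T x y t c) / T

/-- The output of `T` iterations of mirror descent for
`min (1/N) ∑ m, ln (1 + exp (-y m ⟨w, x m⟩))` subject to `‖w‖₁ ≤ W`. -/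
def mirrorDescent {n N : ℕ} (W : ℝ) (T : ℕ) (x : Fin N → Fin n → ℝ) (y : Fin N → ℝ) :
    Fin n → ℝ := fun j =>
  (mdAverage W T x y (.inl (.inl j)) - mdAverage W T x y (.inl (.inr j))) * W

/-! ### Learning the Ising model -/

/-- The regression vector for node `i`: the spins of the other nodes together with a
constant coordinate `1`. The constant occupies the slot `i` left free by the removed spin
(so that no relabelling of the other coordinates is needed). -/
def nodeFeature {n : ℕ} (i : Fin n) (z : Fin n → ℤˣ) : Fin n → ℝ := fun j =>
  if j = i then 1 else spin (z j)

/-- The estimated weight matrix: row `i` is half of the mirror descent solution, with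
`ℓ₁` bound `2 * lam`, of the logistic regression of node `i` on the other nodes. -/
def isingEstimate {n N : ℕ} (lam : ℝ) (T : ℕ) (z : Fin N → Fin n → ℤˣ) :
    Matrix (Fin n) (Fin n) ℝ := fun i j =>
  if j = i then 0 else
    mirrorDescent (2 * lam) T (fun m => nodeFeature i (z m)) (fun m => spin (z m i)) j / 2

/-- The estimated graph, with edges `{(i,j) : i < j, |Â i j| ≥ η / 2}`. -/
def isingGraphEstimate {n N : ℕ} (lam eta : ℝ) (T : ℕ) (z : Fin N → Fin n → ℤˣ) :
    SimpleGraph (Fin n) :=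
  SimpleGraph.fromRel fun i j => i < j ∧ eta / 2 ≤ |isingEstimate lam T z i j|

/-! ### A real RAM: structured programs over natural-number registers (used as loop counters
and addresses), real registers and real arrays, with unit cost for every operation -/

namespace RealRAM

/-- Memory: natural-number registers `I`, real registers `R`, real arrays `A`. -/
structure Memory (I R A : Type) where
  nat : I → ℕ
  real : R → ℝ
  arr : A → ℕ → ℝ

/-- Index expressions. -/
inductive NExp (I : Type) : Type
  | lit (k : ℕ)
  | var (x : I)
  | add (a b : NExp I)
  | mul (a b : NExp I)

/-- Real expressions; `get a e` reads the cell `e` of the array `a`. -/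
inductive RExp (I R A : Type) : Type
  | lit (k : ℕ)
  | cast (e : NExp I)
  | var (x : R)
  | get (a : A) (e : NExp I)
  | neg (a : RExp I R A)
  | add (a b : RExp I R A)
  | sub (a b : RExp I R A)
  | mul (a b : RExp I R A)
  | div (a b : RExp I R A)
  | abs (a : RExp I R A)
  | exp (a : RExp I R A)
  | log (a : RExp I R A)
  | sqrt (a : RExp I R A)

/-- Tests. -/
inductive Test (I R A : Type) : Type
  | natEq (a b : NExp I)
  | natLt (a b : NExp I)
  | realLe (a b : RExp I R A)

/-- Commands; `forTo x e p` runs `p` with `x = 0, 1, …, e - 1`. -/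
inductive Cmd (I R A : Type) : Type
  | setNat (x : I) (e : NExp I)
  | setReal (x : R) (e : RExp I R A)
  | put (a : A) (k : NExp I) (e : RExp I R A)
  | seq (p q : Cmd I R A)
  | ite (b : Test I R A) (p q : Cmd I R A)
  | forTo (x : I) (e : NExp I) (p : Cmd I R A)

infixr:60 " ;; " => Cmd.seq

variable {I R A : Type}

instance {k : ℕ} : OfNat (NExp I) k := ⟨.lit k⟩
instance : Add (NExp I) := ⟨.add⟩
instance : Mul (NExp I) := ⟨.mul⟩
instance {k : ℕ} : OfNat (RExp I R A) k := ⟨.lit k⟩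
instance : Neg (RExp I R A) := ⟨.neg⟩
instance : Add (RExp I R A) := ⟨.add⟩
instance : Sub (RExp I R A) := ⟨.sub⟩
instance : Mul (RExp I R A) := ⟨.mul⟩
instance : Div (RExp I R A) := ⟨.div⟩

/-- Value of an index expression. -/
def NExp.eval (σ : Memory I R A) : NExp I → ℕ
  | .lit k => k
  | .var x => σ.nat x
  | .add a b => a.eval σ + b.eval σ
  | .mul a b => a.eval σ * b.eval σ

/-- Cost of evaluating an index expression: one step per symbol. -/
def NExp.cost : NExp I → ℕ
  | .lit _ => 1
  | .var _ => 1
  | .add a b => a.cost + b.cost + 1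
  | .mul a b => a.cost + b.cost + 1

/-- Value of a real expression. -/
def RExp.eval (σ : Memory I R A) : RExp I R A → ℝ
  | .lit k => (k : ℝ)
  | .cast e => (e.eval σ : ℝ)
  | .var x => σ.real x
  | .get a e => σ.arr a (e.eval σ)
  | .neg a => -a.eval σ
  | .add a b => a.eval σ + b.eval σ
  | .sub a b => a.eval σ - b.eval σ
  | .mul a b => a.eval σ * b.eval σ
  | .div a b => a.eval σ / b.eval σ
  | .abs a => |a.eval σ|
  | .exp a => Real.exp (a.eval σ)
  | .log a => Real.log (a.eval σ)
  | .sqrt a => √(a.eval σ)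

/-- Cost of evaluating a real expression: one step per symbol. -/
def RExp.cost : RExp I R A → ℕ
  | .lit _ => 1
  | .cast e => e.cost + 1
  | .var _ => 1
  | .get _ e => e.cost + 1
  | .neg a => a.cost + 1
  | .add a b => a.cost + b.cost + 1
  | .sub a b => a.cost + b.cost + 1
  | .mul a b => a.cost + b.cost + 1
  | .div a b => a.cost + b.cost + 1
  | .abs a => a.cost + 1
  | .exp a => a.cost + 1
  | .log a => a.cost + 1
  | .sqrt a => a.cost + 1

/-- Outcome of a test. -/
def Test.Holds (σ : Memory I R A) : Test I R A → Prop
  | .natEq a b => a.eval σ = b.eval σ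
  | .natLt a b => a.eval σ < b.eval σ
  | .realLe a b => a.eval σ ≤ b.eval σ

/-- Cost of a test. -/
def Test.cost : Test I R A → ℕ
  | .natEq a b => a.cost + b.cost + 1
  | .natLt a b => a.cost + b.cost + 1
  | .realLe a b => a.cost + b.cost + 1

/-- Run the loop body for the counter values `0, …, k - 1`, adding up the costs; each
iteration is charged one step in addition to the cost of the body. -/
def loop {S : Type} (body : ℕ → S → S × ℕ) : ℕ → S → S × ℕ
  | 0, σ => (σ, 0)
  | k + 1, σ =>
    let a := loop body k σ
    let b := body k a.1
    (b.1, a.2 + b.2 + 1)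

open Classical in
/-- The memory after execution of a command, and the number of steps used. -/
def Cmd.run [DecidableEq I] [DecidableEq R] [DecidableEq A] :
    Cmd I R A → Memory I R A → Memory I R A × ℕ
  | .setNat x e => fun σ =>
    ({ σ with nat := Function.update σ.nat x (e.eval σ) }, e.cost + 1)
  | .setReal x e => fun σ =>
    ({ σ with real := Function.update σ.real x (e.eval σ) }, e.cost + 1)
  | .put a k e => fun σ =>
    let cells := Function.update (σ.arr a) (k.eval σ) (e.eval σ)
    ({ σ with arr := Function.update σ.arr a cells }, k.cost + e.cost + 1)
  | .seq p q => fun σ =>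
    let s := p.run σ
    let t := q.run s.1
    (t.1, s.2 + t.2)
  | .ite b p q => fun σ =>
    let s := if b.Holds σ then p.run σ else q.run σ
    (s.1, s.2 + b.cost)
  | .forTo x e p => fun σ =>
    let s := loop (fun k τ => p.run { τ with nat := Function.update τ.nat x k }) (e.eval σ) σ
    (s.1, s.2 + e.cost + 1)

end RealRAM

/-! ### The learning algorithm as a real RAM program -/

namespace IsingProgram

open RealRAM

/-- Natural-number registers: the inputs `n, N, T` and counters. -/
inductive NReg
  | n | N | T | i | m | t | j | k
  deriving DecidableEq

/-- Real registers: the inputs `lam, eta` and auxiliary values. -/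
inductive RReg
  | lam | eta | W | gam | s | total
  deriving DecidableEq

/-- Arrays: the input samples `z`, auxiliary arrays, the outputs `Ahat` and `edge`. -/
inductive Arr
  | z | xhat | yhat | w | acc | g | Ahat | edge
  deriving DecidableEq

abbrev Prog : Type := Cmd NReg RReg Arr

/-- The register `r` as an index expression. -/
abbrev nv (r : NReg) : NExp NReg := .var r

/-- The register `r` as a real expression. -/
abbrev rv (r : RReg) : RExp NReg RReg Arr := .var r

/-- The array cell `a[e]`. -/
abbrev cell (a : Arr) (e : NExp NReg) : RExp NReg RReg Arr := .get a e

/-- `2n + 1`. -/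
abbrev dim : NExp NReg := 2 * nv .n + 1

/-- Form the lifted samples `[x, -x, 0] * W` and labels `(y + 1) / 2` for node `i`. -/
def formSamples : Prog :=
  .forTo .m (nv .N) (
    .forTo .j (nv .n) (
      .ite (.natEq (nv .j) (nv .i))
        (.setReal .s 1)
        (.setReal .s (cell .z (nv .m * nv .n + nv .j))) ;;
      .put .xhat (nv .m * dim + nv .j) (rv .s * rv .W) ;;
      .put .xhat (nv .m * dim + (nv .n + nv .j)) (-rv .s * rv .W)) ;;
    .put .xhat (nv .m * dim + 2 * nv .n) 0 ;;
    .put .yhat (nv .m) ((cell .z (nv .m * nv .n + nv .i) + 1) / 2))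

/-- Initialize `w` as the uniform distribution and set the step size. -/
def setUp : Prog :=
  .forTo .k dim (
    .put .w (nv .k) (1 / .cast dim) ;;
    .put .acc (nv .k) 0) ;;
  .setReal .gam (1 / (2 * rv .W) * .sqrt (2 * .log (.cast dim) / .cast (nv .T)))

/-- Add the current iterate to the running sum. -/
def accumulate : Prog :=
  .forTo .k dim (.put .acc (nv .k) (cell .acc (nv .k) + cell .w (nv .k)))

/-- Compute the gradient at the current iterate. -/
def gradient : Prog :=
  .forTo .k dim (.put .g (nv .k) 0) ;;
  .forTo .m (nv .N) (
    .setReal .s 0 ;;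
    .forTo .k dim (
      .setReal .s (rv .s + cell .w (nv .k) * cell .xhat (nv .m * dim + nv .k))) ;;
    .setReal .s (1 / (1 + .exp (-rv .s)) - cell .yhat (nv .m)) ;;
    .forTo .k dim (
      .put .g (nv .k) (cell .g (nv .k) + rv .s * cell .xhat (nv .m * dim + nv .k)))) ;;
  .forTo .k dim (.put .g (nv .k) (cell .g (nv .k) / .cast (nv .N)))

/-- Coordinatewise multiplicative update, then `ℓ₁` normalization. -/
def update : Prog :=
  .forTo .k dim (.put .w (nv .k) (cell .w (nv .k) * .exp (-rv .gam * cell .g (nv .k)))) ;;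
  .setReal .total 0 ;;
  .forTo .k dim (.setReal .total (rv .total + .abs (cell .w (nv .k)))) ;;
  .forTo .k dim (.put .w (nv .k) (cell .w (nv .k) / rv .total))

/-- Average, transform back, and write row `i` of the estimated weight matrix. -/
def writeRow : Prog :=
  .forTo .k dim (.put .acc (nv .k) (cell .acc (nv .k) / .cast (nv .T))) ;;
  .forTo .j (nv .n) (
    .ite (.natEq (nv .j) (nv .i))
      (.put .Ahat (nv .i * nv .n + nv .j) 0)
      (.put .Ahat (nv .i * nv .n + nv .j)
        ((cell .acc (nv .j) - cell .acc (nv .n + nv .j)) * rv .W / 2)))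

/-- Write the adjacency matrix (entries `0` and `1`) of the estimated graph. -/
def writeGraph : Prog :=
  .forTo .i (nv .n) (
    .forTo .j (nv .n) (
      .ite (.natLt (nv .i) (nv .j))
        (.setNat .k (nv .i * nv .n + nv .j))
        (.setNat .k (nv .j * nv .n + nv .i)) ;;
      .ite (.natEq (nv .i) (nv .j))
        (.put .edge (nv .i * nv .n + nv .j) 0)
        (.ite (.realLe (rv .eta / 2) (.abs (cell .Ahat (nv .k))))
          (.put .edge (nv .i * nv .n + nv .j) 1)
          (.put .edge (nv .i * nv .n + nv .j) 0))))

/-- The whole algorithm. -/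
def learnIsing : Prog :=
  .setReal .W (2 * rv .lam) ;;
  .forTo .i (nv .n) (
    formSamples ;;
    setUp ;;
    .forTo .t (nv .T) (accumulate ;; gradient ;; update) ;;
    writeRow) ;;
  writeGraph

/-- The initial memory: `n, N, T, lam, eta` in their registers, the samples in row-major
order in the array `z` (sample `m`, node `i` in cell `m * n + i`), all else `0`. -/
def input {n N : ℕ} (T : ℕ) (lam eta : ℝ) (z : Fin N → Fin n → ℤˣ) :
    Memory NReg RReg Arr where
  nat := fun
    | .n => n
    | .N => N
    | .T => T
    | _ => 0
  real := fun
    | .lam => lam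
    | .eta => eta
    | _ => 0
  arr := fun
    | .z => fun c =>
      if h : c < N * n then
        spin (z (finProdFinEquiv.symm ⟨c, h⟩).1 (finProdFinEquiv.symm ⟨c, h⟩).2)
      else 0
    | _ => fun _ => 0

/-- The memory when the program has stopped. -/
def output {n N : ℕ} (T : ℕ) (lam eta : ℝ) (z : Fin N → Fin n → ℤˣ) :
    Memory NReg RReg Arr :=
  (learnIsing.run (input T lam eta z)).1

/-- The number of steps that the program takes. -/
def steps {n N : ℕ} (T : ℕ) (lam eta : ℝ) (z : Fin N → Fin n → ℤˣ) : ℕ :=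
  (learnIsing.run (input T lam eta z)).2

end IsingProgram

end

/-! Statistics. Flipping spin i multiplies the Ising probability by exp(-2 z_i H_i), where H_i is
the local field (`isingPMF_flipSpin`); this says that z_i given the other spins follows a logistic
law. Hence the population logistic gradient vanishes at v = 2(A_i, θ_i)
(`expected_gradient_eq_zero`), a point of the ℓ₁ ball of radius W = 2λ. The same identity at a node
j ≠ i shows that a flip of z_j costs at most a factor e^{-2λ} in probability, so the second-moment
form of the features is at least e^{-2λ} a_j² (`featureMoment_lower_bound`). Hoeffding and a union
bound over n² + n³ statistics make the empirical gradient at v and the empirical second moments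
accurate up to h, with h² of order ln(n/ρ)/N.

Optimization. The remaining argument is deterministic (`mirrorDescent_error`). The regret of
exponentiated gradient bounds the average over t of ⟨g^t, w^t - u⟩, with u a simplex point
representing v, by O(W √(ln n / T)). Strong monotonicity of σ on [-W, W] bounds each such term below
by (e^{-W}/4) times the second-moment form at the current error vector, up to terms linear in h;
values of the loss never enter. With the moment bound and convexity of the square, e^{-4λ}(A_ij -
Â_ij)² is O(λ(√(ln n / T) + h)), and the stated T and N push this below ε² e^{-6λ}.

Program. Correctness (`output_correct`) is by loop invariants, together with a syntactic frame rule: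
a command changes only the locations it mentions as targets. For the cost (`steps_le`), every loop
bound depends only on n, N, T, which are never assigned, so the loop bounds can be read off the
initial memory and the cost is at most an explicit polynomial. -/

namespace RealRAM

/-! ### Frame rule and loop invariants for real RAM programs. -/

section
variable {I R A : Type}

theorem NExp.eval_var (σ : Memory I R A) (x : I) : (NExp.var x).eval σ = σ.nat x := rfl

/-- The body of a loop preserves an indexed invariant, hence so does the loop. -/
theorem loop_induction {S : Type} {body : ℕ → S → S × ℕ} (P : ℕ → S → Prop) {K : ℕ} {σ : S}
    (h0 : P 0 σ) (hs : ∀ k < K, ∀ s, P k s → P (k + 1) (body k s).1) :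
    P K (loop body K σ).1 := by
  induction K with
  | zero => exact h0
  | succ K ih => exact hs K (by omega) _ (ih fun k hk => hs k (by omega))

variable [DecidableEq I] [DecidableEq R] [DecidableEq A]

/-- Whether a command assigns to a natural-number register. -/
def Cmd.writesNat : Cmd I R A → I → Bool
  | .setNat x _, y => decide (x = y)
  | .setReal _ _, _ => false
  | .put _ _ _, _ => false
  | .seq p q, y => p.writesNat y || q.writesNat y
  | .ite _ p q, y => p.writesNat y || q.writesNat y
  | .forTo x _ p, y => decide (x = y) || p.writesNat y

/-- Whether a command assigns to a real register. -/
def Cmd.writesReal : Cmd I R A → R → Bool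
  | .setNat _ _, _ => false
  | .setReal x _, y => decide (x = y)
  | .put _ _ _, _ => false
  | .seq p q, y => p.writesReal y || q.writesReal y
  | .ite _ p q, y => p.writesReal y || q.writesReal y
  | .forTo _ _ p, y => p.writesReal y

/-- Whether a command writes to an array. -/
def Cmd.writesArr : Cmd I R A → A → Bool
  | .setNat _ _, _ => false
  | .setReal _ _, _ => false
  | .put a _ _, b => decide (a = b)
  | .seq p q, b => p.writesArr b || q.writesArr b
  | .ite _ p q, b => p.writesArr b || q.writesArr b
  | .forTo _ _ p, b => p.writesArr b

/-- Two memories agree on everything that a command does not write. -/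
structure Cmd.Frame (p : Cmd I R A) (σ τ : Memory I R A) : Prop where
  nat : ∀ y, p.writesNat y = false → τ.nat y = σ.nat y
  real : ∀ y, p.writesReal y = false → τ.real y = σ.real y
  arr : ∀ b, p.writesArr b = false → τ.arr b = σ.arr b

theorem Cmd.Frame.rfl {p : Cmd I R A} {σ : Memory I R A} : p.Frame σ σ :=
  ⟨fun _ _ => Eq.refl _, fun _ _ => Eq.refl _, fun _ _ => Eq.refl _⟩

theorem Cmd.Frame.trans {p : Cmd I R A} {σ τ υ : Memory I R A} (h₁ : p.Frame σ τ)
    (h₂ : p.Frame τ υ) : p.Frame σ υ :=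
  ⟨fun y h => (h₂.nat y h).trans (h₁.nat y h), fun y h => (h₂.real y h).trans (h₁.real y h),
    fun y h => (h₂.arr y h).trans (h₁.arr y h)⟩

/-- A smaller set of written locations gives a stronger frame. -/
theorem Cmd.Frame.mono {p q : Cmd I R A} {σ τ : Memory I R A} (h : p.Frame σ τ)
    (hn : ∀ y, q.writesNat y = false → p.writesNat y = false)
    (hr : ∀ y, q.writesReal y = false → p.writesReal y = false)
    (ha : ∀ y, q.writesArr y = false → p.writesArr y = false) : q.Frame σ τ :=
  ⟨fun y hy => h.nat y (hn y hy), fun y hy => h.real y (hr y hy), fun y hy => h.arr y (ha y hy)⟩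

/-- Setting the counter of a loop respects the frame of the loop. -/
theorem Cmd.frame_counter (x : I) (e : NExp I) (p : Cmd I R A) (s : Memory I R A) (k : ℕ) :
    (Cmd.forTo x e p).Frame s { s with nat := Function.update s.nat x k } := by
  refine ⟨fun y hy => ?_, fun _ _ => Eq.refl _, fun _ _ => Eq.refl _⟩
  have : y ≠ x := by
    rintro rfl
    simp [Cmd.writesNat] at hy
  simp [this]

theorem Cmd.Frame.forTo {x : I} {e : NExp I} {p : Cmd I R A} {σ τ : Memory I R A}
    (h : p.Frame σ τ) : (Cmd.forTo x e p).Frame σ τ :=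
  h.mono (by simp [Cmd.writesNat]) (by simp [Cmd.writesReal]) (by simp [Cmd.writesArr])

/-- Structural induction; for a loop, the frame relation to the starting memory is itself the
invariant. Write sets are Boolean-valued, so for a concrete program "this location is untouched" is
checked by computation. -/
theorem Cmd.run_frame (p : Cmd I R A) (σ : Memory I R A) : p.Frame σ (p.run σ).1 := by
  induction p generalizing σ with
  | setNat x e =>
    refine ⟨fun y hy => ?_, fun _ _ => Eq.refl _, fun _ _ => Eq.refl _⟩
    have : y ≠ x := by
      rintro rfl
      simp [Cmd.writesNat] at hy
    simp [Cmd.run, this]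
  | setReal x e =>
    refine ⟨fun _ _ => Eq.refl _, fun y hy => ?_, fun _ _ => Eq.refl _⟩
    have : y ≠ x := by
      rintro rfl
      simp [Cmd.writesReal] at hy
    simp [Cmd.run, this]
  | put a k e =>
    refine ⟨fun _ _ => Eq.refl _, fun _ _ => Eq.refl _, fun y hy => ?_⟩
    have : y ≠ a := by
      rintro rfl
      simp [Cmd.writesArr] at hy
    simp [Cmd.run, this]
  | seq p q ihp ihq =>
    refine Cmd.Frame.trans (τ := (p.run σ).1) ?_ ?_
    · exact (ihp σ).mono (by simp +contextual [Cmd.writesNat])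
        (by simp +contextual [Cmd.writesReal]) (by simp +contextual [Cmd.writesArr])
    · exact (ihq _).mono (by simp +contextual [Cmd.writesNat])
        (by simp +contextual [Cmd.writesReal]) (by simp +contextual [Cmd.writesArr])
  | ite b p q ihp ihq =>
    by_cases h : b.Holds σ
    · simp only [Cmd.run, if_pos h]
      exact (ihp σ).mono (by simp +contextual [Cmd.writesNat])
        (by simp +contextual [Cmd.writesReal]) (by simp +contextual [Cmd.writesArr])
    · simp only [Cmd.run, if_neg h]
      exact (ihq σ).mono (by simp +contextual [Cmd.writesNat])
        (by simp +contextual [Cmd.writesReal]) (by simp +contextual [Cmd.writesArr])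
  | forTo x e p ih =>
    refine loop_induction (fun _ s => (Cmd.forTo x e p).Frame σ s) Cmd.Frame.rfl
      fun k _ s hs => ?_
    exact (hs.trans (Cmd.frame_counter x e p s k)).trans (ih _).forTo

/-- The invariant rule for counting loops, for an invariant that does not mention the
counter. -/
theorem Cmd.forTo_induction {x : I} {e : NExp I} {p : Cmd I R A} {σ : Memory I R A} {K : ℕ}
    (P : ℕ → Memory I R A → Prop) (hK : e.eval σ = K)
    (hx : ∀ k s v, P k s → P k { s with nat := Function.update s.nat x v }) (h0 : P 0 σ)
    (hs : ∀ k < K, ∀ s, (Cmd.forTo x e p).Frame σ s → s.nat x = k → P k s →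
      P (k + 1) (p.run s).1) :
    P K ((Cmd.forTo x e p).run σ).1 := by
  subst hK
  -- The frame is carried along with the invariant, so that the body may use that everything the
  -- loop does not write still has its initial value.
  refine (loop_induction (fun k s => (Cmd.forTo x e p).Frame σ s ∧ P k s) ⟨Cmd.Frame.rfl, h0⟩
    fun k hk s ⟨hs₁, hs₂⟩ => ?_).2
  have hf := hs₁.trans (Cmd.frame_counter x e p s k)
  exact ⟨hf.trans (Cmd.run_frame p _).forTo,
    hs k hk _ hf (by simp) (hx k s k hs₂)⟩

theorem Cmd.run_seq (p q : Cmd I R A) (σ : Memory I R A) :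
    ((Cmd.seq p q).run σ).1 = (q.run (p.run σ).1).1 := rfl

theorem Cmd.run_ite_pos {b : Test I R A} {p q : Cmd I R A} {σ : Memory I R A}
    (h : b.Holds σ) : ((Cmd.ite b p q).run σ).1 = (p.run σ).1 := by
  simp [Cmd.run, h]

theorem Cmd.run_ite_neg {b : Test I R A} {p q : Cmd I R A} {σ : Memory I R A}
    (h : ¬ b.Holds σ) : ((Cmd.ite b p q).run σ).1 = (q.run σ).1 := by
  simp [Cmd.run, h]

theorem Cmd.run_put_arr (a : A) (k : NExp I) (e : RExp I R A) (σ : Memory I R A) :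
    ((Cmd.put a k e).run σ).1.arr a = Function.update (σ.arr a) (k.eval σ) (e.eval σ) := by
  simp [Cmd.run]

theorem Cmd.run_setReal_real (x : R) (e : RExp I R A) (σ : Memory I R A) :
    ((Cmd.setReal x e).run σ).1.real x = e.eval σ := by
  simp [Cmd.run]

theorem Cmd.run_setNat_nat (x : I) (e : NExp I) (σ : Memory I R A) :
    ((Cmd.setNat x e).run σ).1.nat x = e.eval σ := by
  simp [Cmd.run]

/-- A loop that assigns to consecutive cells of an array. -/
theorem Cmd.run_map_loop {x : I} {e : NExp I} {a : A} {ex : RExp I R A} {σ : Memory I R A}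
    {K : ℕ} (F : ℕ → ℝ) (hK : e.eval σ = K)
    (hF : ∀ k < K, ∀ s, (Cmd.forTo x e (.put a (.var x) ex)).Frame σ s → s.nat x = k →
      s.arr a k = σ.arr a k → ex.eval s = F k) (l : ℕ) :
    ((Cmd.forTo x e (.put a (.var x) ex)).run σ).1.arr a l
      = if l < K then F l else σ.arr a l := by
  -- Cells from k on still hold their initial values, which lets the expression read the very cell
  -- that it overwrites.
  refine Cmd.forTo_induction (fun k s => ∀ l, s.arr a l = if l < k then F l else σ.arr a l) hK
    (fun _ _ _ h => h) (by simp) (fun k hk s hs hx h l => ?_) l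
  rw [Cmd.run_put_arr, hF k hk s hs hx (by simp [h])]
  simp only [NExp.eval_var, hx, Function.update_apply, h]
  by_cases h₁ : l = k
  · simp [h₁]
  · have : l < k ↔ l < k + 1 := by omega
    simp [h₁, this]

/-- A loop that adds up values in a real register. -/
theorem Cmd.run_sum_loop {x : I} {e : NExp I} {r : R} {ex : RExp I R A} {σ : Memory I R A}
    {K : ℕ} (F : ℕ → ℝ) (hK : e.eval σ = K)
    (hF : ∀ k < K, ∀ s, (Cmd.forTo x e (.setReal r (.add (.var r) ex))).Frame σ s →
      s.nat x = k → ex.eval s = F k) :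
    ((Cmd.forTo x e (.setReal r (.add (.var r) ex))).run σ).1.real r
      = σ.real r + ∑ k ∈ Finset.range K, F k := by
  refine Cmd.forTo_induction (fun k s => s.real r = σ.real r + ∑ k ∈ Finset.range k, F k) hK
    (fun _ _ _ h => h) (by simp) (fun k hk s hs hx h => ?_)
  rw [Cmd.run_setReal_real, Finset.sum_range_succ, ← add_assoc, ← h, ← hF k hk s hs hx]
  rfl

end

end RealRAM

/-! ### Correctness of the learning program. -/

namespace IsingProgram

open RealRAM

/-- The position of a lifted coordinate in the arrays of the program. -/
def liftIndex {n : ℕ} : LiftedCoord n → ℕ :=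
  Sum.elim (Sum.elim (fun j => j) (fun j => n + j)) (fun _ => 2 * n)

theorem liftIndex_lt {n : ℕ} (c : LiftedCoord n) : liftIndex c < 2 * n + 1 := by
  rcases c with (j | j) | j <;> simp [liftIndex] <;> omega

theorem liftIndex_injective {n : ℕ} :
    Function.Injective (liftIndex : LiftedCoord n → ℕ) := by
  rintro ((j | j) | j) ((j' | j') | j') h <;> simp [liftIndex] at h ⊢ <;> omega

theorem exists_liftIndex {n k : ℕ} (hk : k < 2 * n + 1) :
    ∃ c : LiftedCoord n, liftIndex c = k := by
  by_cases h₁ : k < n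
  · exact ⟨.inl (.inl ⟨k, h₁⟩), rfl⟩
  by_cases h₂ : k < 2 * n
  · exact ⟨.inl (.inr ⟨k - n, by omega⟩), by simp [liftIndex]; omega⟩
  · exact ⟨.inr (), by simp [liftIndex]; omega⟩

theorem sum_range_eq_sum_lifted {n : ℕ} {f : ℕ → ℝ} {F : LiftedCoord n → ℝ}
    (h : ∀ c, f (liftIndex c) = F c) : ∑ k ∈ Finset.range (2 * n + 1), f k = ∑ c, F c := by
  rw [Finset.sum_range_succ, two_mul, Finset.sum_range_add, Fintype.sum_sum_type,
    Fintype.sum_sum_type, Finset.sum_range, Finset.sum_range]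
  simp [← h, liftIndex, two_mul]

/-- The memory holds the input data and the radius. -/
structure Ready {n N : ℕ} (T : ℕ) (lam eta : ℝ) (z : Fin N → Fin n → ℤˣ)
    (σ : Memory NReg RReg Arr) : Prop where
  nat_n : σ.nat .n = n
  nat_N : σ.nat .N = N
  nat_T : σ.nat .T = T
  real_W : σ.real .W = 2 * lam
  real_eta : σ.real .eta = eta
  arr_z : ∀ (m : Fin N) (j : Fin n), σ.arr .z (m * n + j) = spin (z m j)

section

variable {n N T : ℕ} {lam eta : ℝ} {z : Fin N → Fin n → ℤˣ} {σ τ : Memory NReg RReg Arr}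

/-- The side conditions are closed Boolean computations on the program text, hence the default
proofs by `rfl`. -/
theorem Ready.of_frame {p : Prog} (h : Ready T lam eta z σ) (hf : p.Frame σ τ)
    (hn : p.writesNat .n = false := by rfl) (hN : p.writesNat .N = false := by rfl)
    (hT : p.writesNat .T = false := by rfl) (hW : p.writesReal .W = false := by rfl)
    (he : p.writesReal .eta = false := by rfl) (hz : p.writesArr .z = false := by rfl) :
    Ready T lam eta z τ where
  nat_n := (hf.nat _ hn).trans h.nat_n
  nat_N := (hf.nat _ hN).trans h.nat_N
  nat_T := (hf.nat _ hT).trans h.nat_T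
  real_W := (hf.real _ hW).trans h.real_W
  real_eta := (hf.real _ he).trans h.real_eta
  arr_z m j := by rw [hf.arr _ hz, h.arr_z]

theorem Ready.eval_dim (h : Ready T lam eta z σ) : dim.eval σ = 2 * n + 1 :=
  congrArg (fun k => 2 * k + 1) h.nat_n

theorem Ready.eval_cast_dim (h : Ready T lam eta z σ) :
    (RExp.cast dim : RExp NReg RReg Arr).eval σ = 2 * (n : ℝ) + 1 := by
  change ((dim.eval σ : ℕ) : ℝ) = _
  rw [h.eval_dim]
  push_cast
  ring

/-- The arrays `xhat` and `yhat` hold the lifted samples and labels of node `i`. -/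
structure Formed (lam : ℝ) (z : Fin N → Fin n → ℤˣ) (i : Fin n) (M : ℕ)
    (σ : Memory NReg RReg Arr) : Prop where
  xhat : ∀ m : Fin N, m < M → ∀ c, σ.arr .xhat (m * (2 * n + 1) + liftIndex c)
    = liftSample (2 * lam) (nodeFeature i (z m)) c
  yhat : ∀ m : Fin N, m < M → σ.arr .yhat m = (spin (z m i) + 1) / 2

theorem Formed.of_frame {p : Prog} {i : Fin n} {M : ℕ} (h : Formed lam z i M σ)
    (hf : p.Frame σ τ) (hx : p.writesArr .xhat = false := by rfl)
    (hy : p.writesArr .yhat = false := by rfl) : Formed lam z i M τ where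
  xhat m hm c := by rw [hf.arr _ hx, h.xhat m hm]
  yhat m hm := by rw [hf.arr _ hy, h.yhat m hm]

/-- Writes the two entries of a lifted sample that belong to one coordinate. -/
abbrev formEntry : Prog :=
  .ite (.natEq (nv .j) (nv .i))
    (.setReal .s 1)
    (.setReal .s (cell .z (nv .m * nv .n + nv .j))) ;;
  .put .xhat (nv .m * dim + nv .j) (rv .s * rv .W) ;;
  .put .xhat (nv .m * dim + (nv .n + nv .j)) (-rv .s * rv .W)

theorem formEntry_run {i j : Fin n} {m : Fin N} (h : Ready T lam eta z σ) (hi : σ.nat .i = i)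
    (hm : σ.nat .m = m) (hj : σ.nat .j = j) :
    (formEntry.run σ).1.arr .xhat = Function.update
      (Function.update (σ.arr .xhat) (m * (2 * n + 1) + j) (nodeFeature i (z m) j * (2 * lam)))
      (m * (2 * n + 1) + (n + j)) (-nodeFeature i (z m) j * (2 * lam)) := by
  set p : Prog := .ite (.natEq (nv .j) (nv .i)) (.setReal .s 1)
    (.setReal .s (cell .z (nv .m * nv .n + nv .j))) with hp
  have hs : (p.run σ).1.real .s = nodeFeature i (z m) j := by
    by_cases hij : j = i
    · have hb : (Test.natEq (nv .j) (nv .i) : Test NReg RReg Arr).Holds σ := by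
        change σ.nat .j = σ.nat .i
        rw [hi, hj, hij]
      rw [hp, Cmd.run_ite_pos hb,
        Cmd.run_setReal_real, nodeFeature, if_pos hij]
      exact Nat.cast_one
    · have hb : ¬ (Test.natEq (nv .j) (nv .i) : Test NReg RReg Arr).Holds σ := by
        change ¬ σ.nat .j = σ.nat .i
        rw [hi, hj]
        exact fun h => hij (Fin.ext h)
      rw [hp, Cmd.run_ite_neg hb, Cmd.run_setReal_real, nodeFeature,
        if_neg hij, ← h.arr_z m j]
      change σ.arr .z (σ.nat .m * σ.nat .n + σ.nat .j) = _
      rw [hm, hj, h.nat_n]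
  have hf := Cmd.run_frame p σ
  have hr := h.of_frame hf
  have hm₁ := (hf.nat .m rfl).trans hm
  have hj₁ := (hf.nat .j rfl).trans hj
  have hx₁ := hf.arr .xhat rfl
  change (((_ ;; _ : Prog).run (p.run σ).1).1).arr .xhat = _
  generalize (p.run σ).1 = s at *
  rw [Cmd.run_seq, Cmd.run_put_arr]
  have hf := Cmd.run_frame (.put .xhat (nv .m * dim + nv .j) (rv .s * rv .W) : Prog) s
  have hr₂ := hr.of_frame hf
  have h₁ : (nv .m * dim + (nv .n + nv .j)).eval
      ((Cmd.put .xhat (nv .m * dim + nv .j) (rv .s * rv .W) : Prog).run s).1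
      = m * (2 * n + 1) + (n + j) := by
    change s.nat .m * (2 * s.nat .n + 1) + (s.nat .n + s.nat .j) = _
    rw [hm₁, hj₁, hr.nat_n]
  have h₂ : (nv .m * dim + nv .j).eval s = m * (2 * n + 1) + j := by
    change s.nat .m * (2 * s.nat .n + 1) + s.nat .j = _
    rw [hm₁, hj₁, hr.nat_n]
  have h₃ : (-rv .s * rv .W).eval
      ((Cmd.put .xhat (nv .m * dim + nv .j) (rv .s * rv .W) : Prog).run s).1
      = -nodeFeature i (z m) j * (2 * lam) := by
    change -s.real .s * s.real .W = _
    rw [hs, hr.real_W]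
  have h₄ : (rv .s * rv .W).eval s = nodeFeature i (z m) j * (2 * lam) := by
    change s.real .s * s.real .W = _
    rw [hs, hr.real_W]
  rw [h₁, h₃, Cmd.run_put_arr, h₂, h₄, hx₁]

/-- All writes for sample m go to addresses at least m(2n+1). The first conjunct records this; it
keeps the rows of earlier samples intact in the outer loop. -/
theorem formRow_run {i : Fin n} {m : Fin N} (h : Ready T lam eta z σ) (hi : σ.nat .i = i)
    (hm : σ.nat .m = m) :
    (∀ l < (m : ℕ) * (2 * n + 1),
      ((Cmd.forTo .j (nv .n) formEntry).run σ).1.arr .xhat l = σ.arr .xhat l) ∧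
    ∀ j : Fin n, (j : ℕ) < n →
      ((Cmd.forTo .j (nv .n) formEntry).run σ).1.arr .xhat (m * (2 * n + 1) + j)
        = nodeFeature i (z m) j * (2 * lam) ∧
      ((Cmd.forTo .j (nv .n) formEntry).run σ).1.arr .xhat (m * (2 * n + 1) + (n + j))
        = -nodeFeature i (z m) j * (2 * lam) := by
  let P : ℕ → Memory NReg RReg Arr → Prop := fun k s =>
    (∀ l < (m : ℕ) * (2 * n + 1), s.arr .xhat l = σ.arr .xhat l) ∧ ∀ j : Fin n, (j : ℕ) < k →
      s.arr .xhat (m * (2 * n + 1) + j) = nodeFeature i (z m) j * (2 * lam) ∧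
      s.arr .xhat (m * (2 * n + 1) + (n + j)) = -nodeFeature i (z m) j * (2 * lam)
  suffices hP : P n ((Cmd.forTo .j (nv .n) formEntry).run σ).1 from hP
  refine Cmd.forTo_induction P h.nat_n (fun _ _ _ h => h) ⟨fun _ _ => rfl, fun _ hj => by omega⟩
    fun k hk s hf hj ⟨h₁, h₂⟩ => ?_
  have hrun := formEntry_run (j := ⟨k, hk⟩) (h.of_frame hf) ((hf.nat .i rfl).trans hi)
    ((hf.nat .m rfl).trans hm) hj
  change (∀ l < _, _) ∧ ∀ j : Fin n, _
  rw [hrun]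
  refine ⟨fun l hl => ?_, fun j hj => ?_⟩
  · rw [Function.update_of_ne (by omega), Function.update_of_ne (by simp only; omega), h₁ l hl]
  · have hjn := j.isLt
    rcases eq_or_ne (j : ℕ) k with hjk | hjk
    · obtain rfl : j = ⟨k, hk⟩ := Fin.ext hjk
      rw [Function.update_of_ne (by simp only; omega), Function.update_self,
        Function.update_self]
      exact ⟨rfl, rfl⟩
    · rw [Function.update_of_ne (by simp only; omega),
        Function.update_of_ne (by simp only; omega),
        Function.update_of_ne (by simp only; omega), Function.update_of_ne (by simp only; omega)]
      exact h₂ j (by omega)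

theorem formSamples_run {i : Fin n} (h : Ready T lam eta z σ) (hi : σ.nat .i = i) :
    Formed lam z i N (formSamples.run σ).1 := by
  refine Cmd.forTo_induction (fun k s => Formed lam z i k s) h.nat_N (fun _ _ _ h => ⟨h.1, h.2⟩)
    ⟨fun _ hm => absurd hm (by simp), fun _ hm => absurd hm (by simp)⟩
    fun k hk s hf hm ih => ?_
  have hr := h.of_frame hf
  have hi := (hf.nat .i rfl).trans hi
  rw [Cmd.run_seq, Cmd.run_seq]
  obtain ⟨h₁, h₂⟩ := formRow_run (m := ⟨k, hk⟩) hr hi hm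
  have hf₁ := Cmd.run_frame (.forTo .j (nv .n) formEntry) s
  have hr₁ := hr.of_frame hf₁
  have hi₁ := (hf₁.nat .i rfl).trans hi
  have hm₁ := (hf₁.nat .m rfl).trans hm
  have hy₁ := hf₁.arr .yhat rfl
  generalize ((Cmd.forTo .j (nv .n) formEntry).run s).1 = s₁ at *
  have hf₂ := Cmd.run_frame (.put .xhat (nv .m * dim + 2 * nv .n) 0 : Prog) s₁
  have hr₂ := hr₁.of_frame hf₂
  have hi₂ := (hf₂.nat .i rfl).trans hi₁
  have hm₂ := (hf₂.nat .m rfl).trans hm₁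
  have hy₂ := (hf₂.arr .yhat rfl).trans hy₁
  have hx₂ : ((Cmd.put .xhat (nv .m * dim + 2 * nv .n) 0 : Prog).run s₁).1.arr .xhat
      = Function.update (s₁.arr .xhat) (k * (2 * n + 1) + 2 * n) 0 := by
    rw [Cmd.run_put_arr]
    have : (nv .m * dim + 2 * nv .n).eval s₁ = k * (2 * n + 1) + 2 * n := by
      change s₁.nat .m * (2 * s₁.nat .n + 1) + 2 * s₁.nat .n = _
      rw [hm₁, hr₁.nat_n]
    rw [this]
    congr 1
    exact Nat.cast_zero
  generalize ((Cmd.put .xhat (nv .m * dim + 2 * nv .n) 0 : Prog).run s₁).1 = s₂ at *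
  have hf₃ := Cmd.run_frame
    (.put .yhat (nv .m) ((cell .z (nv .m * nv .n + nv .i) + 1) / 2) : Prog) s₂
  have hy₃ : ((Cmd.put .yhat (nv .m) ((cell .z (nv .m * nv .n + nv .i) + 1) / 2) :
      Prog).run s₂).1.arr .yhat
      = Function.update (s₂.arr .yhat) k ((spin (z ⟨k, hk⟩ i) + 1) / 2) := by
    rw [Cmd.run_put_arr]
    have h₃ : (nv .m).eval s₂ = k := hm₂
    have h₄ : ((cell .z (nv .m * nv .n + nv .i) + 1) / 2).eval s₂
        = (spin (z ⟨k, hk⟩ i) + 1) / 2 := by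
      change (s₂.arr .z (s₂.nat .m * s₂.nat .n + s₂.nat .i) + ((1 : ℕ) : ℝ)) / ((2 : ℕ) : ℝ) = _
      rw [hm₂, hi₂, hr₂.nat_n, hr₂.arr_z ⟨k, hk⟩ i]
      norm_num
    rw [h₃, h₄]
  have hx₃ := (hf₃.arr .xhat rfl).trans hx₂
  refine ⟨fun m hmk c => ?_, fun m hmk => ?_⟩
  · rw [hx₃]
    rcases Nat.lt_succ_iff_lt_or_eq.mp hmk with hlt | heq
    · have hc := liftIndex_lt c
      -- The block of an earlier sample ends before the block of sample k begins.
      have hle : (m : ℕ) * (2 * n + 1) + (2 * n + 1) ≤ k * (2 * n + 1) := by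
        rw [← Nat.succ_mul]
        exact Nat.mul_le_mul_right _ hlt
      rw [Function.update_of_ne (by omega), h₁ _ (by simp only; omega), ih.xhat m hlt]
    · obtain rfl : m = ⟨k, hk⟩ := Fin.ext heq
      rcases c with (j | j) | j
      · have := j.isLt
        rw [Function.update_of_ne (by simp [liftIndex]; omega)]
        exact (h₂ j j.isLt).1
      · have := j.isLt
        rw [Function.update_of_ne (by simp [liftIndex]; omega)]
        exact (h₂ j j.isLt).2
      · simp [liftIndex, liftSample]
  · rw [hy₃, hy₂]
    rcases Nat.lt_succ_iff_lt_or_eq.mp hmk with hlt | heq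
    · rw [Function.update_of_ne (by omega), ih.yhat m hlt]
    · obtain rfl : m = ⟨k, hk⟩ := Fin.ext heq
      simp

/-- The array `a` holds the vector `v`. -/
def Holds (a : Arr) (v : LiftedCoord n → ℝ) (σ : Memory NReg RReg Arr) : Prop :=
  ∀ c, σ.arr a (liftIndex c) = v c

theorem Holds.of_frame {a : Arr} {v : LiftedCoord n → ℝ} {p : Prog} {τ : Memory NReg RReg Arr}
    (h : Holds a v σ) (hf : p.Frame σ τ) (ha : p.writesArr a = false := by rfl) :
    Holds a v τ := fun c => by rw [hf.arr _ ha, h c]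

/-- A loop over all cells of an array of length `2 n + 1`. -/
theorem Ready.map_loop (h : Ready T lam eta z σ) {a : Arr} {ex : RExp NReg RReg Arr}
    (v : LiftedCoord n → ℝ)
    (hv : ∀ c s, (Cmd.forTo .k dim (.put a (.var .k) ex)).Frame σ s → s.nat .k = liftIndex c →
      s.arr a (liftIndex c) = σ.arr a (liftIndex c) → ex.eval s = v c) :
    Holds a v ((Cmd.forTo .k dim (.put a (.var .k) ex)).run σ).1 := by
  intro c
  -- The loop rule wants a function on ℕ, so v is transported along a chosen preimage of each
  -- address; injectivity of `liftIndex` makes the choice harmless.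
  rw [Cmd.run_map_loop (fun k => if hk : k < 2 * n + 1 then v (exists_liftIndex hk).choose else 0)
    h.eval_dim, if_pos (liftIndex_lt c), dif_pos (liftIndex_lt c)]
  · exact congrArg v (liftIndex_injective (exists_liftIndex (liftIndex_lt c)).choose_spec)
  · intro k hk s hf hs ha
    rw [dif_pos hk]
    have hc := (exists_liftIndex hk).choose_spec
    exact hv _ s hf (by rw [hs, hc]) (by rw [hc, ha])

theorem setUp_run (h : Ready T lam eta z σ) :
    Holds (n := n) .w (fun _ => 1 / (2 * n + 1)) (setUp.run σ).1 ∧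
    Holds (n := n) .acc (fun _ => 0) (setUp.run σ).1 ∧
    (setUp.run σ).1.real .gam = mdStepSize n (2 * lam) T := by
  set p : Prog := .forTo .k dim (
    .put .w (nv .k) (1 / .cast dim) ;;
    .put .acc (nv .k) 0) with hp
  have hf := Cmd.run_frame p σ
  have hr := h.of_frame hf
  -- This loop fills two arrays at once, so `Ready.map_loop` does not apply and the invariant is
  -- stated directly.
  have hloop : ∀ l < 2 * n + 1, (p.run σ).1.arr .w l = 1 / (2 * n + 1) ∧
      (p.run σ).1.arr .acc l = 0 := by
    let P : ℕ → Memory NReg RReg Arr → Prop := fun k s =>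
      ∀ l < k, s.arr .w l = 1 / (2 * n + 1) ∧ s.arr .acc l = 0
    refine Cmd.forTo_induction P h.eval_dim (fun _ _ _ h => h) (fun _ h => absurd h (by simp))
      fun k hk s hf hk ih => ?_
    have hr := h.of_frame hf
    change ∀ l, _
    rw [Cmd.run_seq, Cmd.run_put_arr,
      (Cmd.run_frame (.put .acc (nv .k) 0 : Prog) _).arr .w rfl, Cmd.run_put_arr,
      (Cmd.run_frame (.put .w (nv .k) (1 / .cast dim) : Prog) _).arr .acc rfl]
    have h₁ : (nv .k).eval s = k := hk
    have h₂ : (nv .k).eval ((Cmd.put .w (nv .k) (1 / .cast dim) : Prog).run s).1 = k := hk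
    have h₃ : (1 / .cast dim : RExp NReg RReg Arr).eval s = 1 / (2 * n + 1) := by
      rw [← hr.eval_cast_dim]
      change ((1 : ℕ) : ℝ) / _ = _
      rw [Nat.cast_one]
    have h₄ : (0 : RExp NReg RReg Arr).eval
      ((Cmd.put .w (nv .k) (1 / .cast dim) : Prog).run s).1 = 0 := Nat.cast_zero
    intro l hl
    rw [h₁, h₂, h₃, h₄]
    rcases Nat.lt_succ_iff_lt_or_eq.mp hl with hlt | rfl
    · rw [Function.update_of_ne (by omega), Function.update_of_ne (by omega)]
      exact ih l hlt
    · simp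
  refine ⟨fun c => (hloop _ (liftIndex_lt c)).1, fun c => (hloop _ (liftIndex_lt c)).2, ?_⟩
  have hg : (setUp.run σ).1.real .gam
      = (1 / (2 * rv .W) * .sqrt (2 * .log (.cast dim) / .cast (nv .T)) :
        RExp NReg RReg Arr).eval (p.run σ).1 := Cmd.run_setReal_real _ _ _
  rw [hg]
  change ((1 : ℕ) : ℝ) / (((2 : ℕ) : ℝ) * (p.run σ).1.real .W)
    * √(((2 : ℕ) : ℝ) * Real.log ((RExp.cast dim : RExp NReg RReg Arr).eval (p.run σ).1)
      / ((p.run σ).1.nat .T : ℕ)) = _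
  rw [hr.real_W, hr.nat_T, hr.eval_cast_dim, mdStepSize]
  norm_num

theorem accumulate_run (h : Ready T lam eta z σ) {v w : LiftedCoord n → ℝ}
    (ha : Holds .acc v σ) (hw : Holds .w w σ) :
    Holds .acc (fun c => v c + w c) (accumulate.run σ).1 := by
  refine h.map_loop _ fun c s hf hs hc => ?_
  change s.arr .acc (s.nat .k) + s.arr .w (s.nat .k) = _
  rw [hs, hc, hf.arr .w rfl, ha c, hw c]

/-- One term of the gradient. -/
noncomputable def gradientTerm (lam : ℝ) (z : Fin N → Fin n → ℤˣ) (i : Fin n) (w : LiftedCoord n → ℝ)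
    (m : Fin N) : ℝ :=
  Real.sigmoid (∑ c, w c * liftSample (2 * lam) (nodeFeature i (z m)) c) - (spin (z m i) + 1) / 2

/-- The contribution of one sample to the gradient. -/
abbrev gradientStep : Prog :=
  .setReal .s 0 ;;
  .forTo .k dim (
    .setReal .s (rv .s + cell .w (nv .k) * cell .xhat (nv .m * dim + nv .k))) ;;
  .setReal .s (1 / (1 + .exp (-rv .s)) - cell .yhat (nv .m)) ;;
  .forTo .k dim (
    .put .g (nv .k) (cell .g (nv .k) + rv .s * cell .xhat (nv .m * dim + nv .k)))

/-- Register `s` is used first for the inner product and then for the residual σ(⟨w, x̂⟩) - ŷ. After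
each command the resulting memory is generalized, so only its recorded properties survive. -/
theorem gradientStep_run {i : Fin n} {m : Fin N} {v w : LiftedCoord n → ℝ}
    (h : Ready T lam eta z σ) (hx : Formed lam z i N σ) (hm : σ.nat .m = m)
    (hg : Holds .g v σ) (hw : Holds .w w σ) :
    Holds .g (fun c => v c + gradientTerm lam z i w m
      * liftSample (2 * lam) (nodeFeature i (z m)) c) (gradientStep.run σ).1 := by
  have hxm : ∀ (s : Memory NReg RReg Arr), Ready T lam eta z s → Formed lam z i N s →
      s.nat .m = m → ∀ c : LiftedCoord n, s.nat .k = liftIndex c →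
      (cell .xhat (nv .m * dim + nv .k)).eval s
        = liftSample (2 * lam) (nodeFeature i (z m)) c := by
    intro s hr hx hm c hk
    change s.arr .xhat (s.nat .m * (2 * s.nat .n + 1) + s.nat .k) = _
    rw [hr.nat_n, hm, hk, hx.xhat m m.isLt c]
  rw [Cmd.run_seq, Cmd.run_seq, Cmd.run_seq]
  have hs₁ : ((Cmd.setReal .s 0 : Prog).run σ).1.real .s = 0 := by
    rw [Cmd.run_setReal_real]
    exact Nat.cast_zero
  have hf := Cmd.run_frame (.setReal .s 0 : Prog) σ
  replace h := h.of_frame hf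
  replace hx := hx.of_frame hf
  replace hm := (hf.nat .m rfl).trans hm
  replace hg := hg.of_frame hf
  replace hw := hw.of_frame hf
  generalize ((Cmd.setReal .s 0 : Prog).run σ).1 = σ at *
  have hs₂ : ((Cmd.forTo .k dim (.setReal .s
      (rv .s + cell .w (nv .k) * cell .xhat (nv .m * dim + nv .k))) : Prog).run σ).1.real .s
      = ∑ c, w c * liftSample (2 * lam) (nodeFeature i (z m)) c := by
    refine (Cmd.run_sum_loop (fun k => if hk : k < 2 * n + 1 then
      w (exists_liftIndex hk).choose * liftSample (2 * lam) (nodeFeature i (z m))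
        (exists_liftIndex hk).choose else 0) h.eval_dim fun k hk s hf hs => ?_).trans ?_
    · rw [dif_pos hk]
      have hc := (exists_liftIndex hk).choose_spec
      change s.arr .w (s.nat .k) * (cell .xhat (nv .m * dim + nv .k)).eval s = _
      rw [hxm s (h.of_frame hf) (hx.of_frame hf) ((hf.nat .m rfl).trans hm)
        (exists_liftIndex hk).choose (by rw [hs, hc]), ← hw.of_frame hf, hs, hc]
    · rw [hs₁, zero_add]
      refine sum_range_eq_sum_lifted fun c => ?_
      rw [dif_pos (liftIndex_lt c)]
      rw [liftIndex_injective (exists_liftIndex (liftIndex_lt c)).choose_spec]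
  have hf := Cmd.run_frame (.forTo .k dim (.setReal .s
      (rv .s + cell .w (nv .k) * cell .xhat (nv .m * dim + nv .k))) : Prog) σ
  replace h := h.of_frame hf
  replace hx := hx.of_frame hf
  replace hm := (hf.nat .m rfl).trans hm
  replace hg := hg.of_frame hf
  replace hw := hw.of_frame hf
  generalize ((Cmd.forTo .k dim (.setReal .s
      (rv .s + cell .w (nv .k) * cell .xhat (nv .m * dim + nv .k))) : Prog).run σ).1 = σ at *
  have hs₃ : ((Cmd.setReal .s (1 / (1 + .exp (-rv .s)) - cell .yhat (nv .m)) : Prog).run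
      σ).1.real .s = gradientTerm lam z i w m := by
    rw [Cmd.run_setReal_real]
    change ((1 : ℕ) : ℝ) / (((1 : ℕ) : ℝ) + Real.exp (-σ.real .s)) - σ.arr .yhat (σ.nat .m) = _
    rw [hs₂, hm, hx.yhat m m.isLt, gradientTerm, Real.sigmoid_def, Nat.cast_one, one_div]
  have hf := Cmd.run_frame
    (.setReal .s (1 / (1 + .exp (-rv .s)) - cell .yhat (nv .m)) : Prog) σ
  replace h := h.of_frame hf
  replace hx := hx.of_frame hf
  replace hm := (hf.nat .m rfl).trans hm
  replace hg := hg.of_frame hf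
  generalize ((Cmd.setReal .s (1 / (1 + .exp (-rv .s)) - cell .yhat (nv .m)) : Prog).run
      σ).1 = σ at *
  refine h.map_loop _ fun c s hf hs hc => ?_
  change s.arr .g (s.nat .k) + s.real .s * (cell .xhat (nv .m * dim + nv .k)).eval s = _
  rw [hxm s (h.of_frame hf) (hx.of_frame hf) ((hf.nat .m rfl).trans hm) c hs, hs, hc, hg c,
    hf.real .s rfl, hs₃]

theorem gradient_run {i : Fin n} {w : LiftedCoord n → ℝ}
    (h : Ready T lam eta z σ) (hx : Formed lam z i N σ) (hw : Holds .w w σ) :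
    Holds .g (mdGradient (2 * lam) (fun m => nodeFeature i (z m)) (fun m => spin (z m i)) w)
      (gradient.run σ).1 := by
  have hr : (gradient.run σ).1 = ((Cmd.forTo .k dim
      (.put .g (nv .k) (cell .g (nv .k) / .cast (nv .N))) : Prog).run
      ((Cmd.forTo .m (nv .N) gradientStep).run
        ((Cmd.forTo .k dim (.put .g (nv .k) 0) : Prog).run σ).1).1).1 := rfl
  rw [hr]
  have hg₁ : Holds (n := n) .g (fun _ => 0)
      ((Cmd.forTo .k dim (.put .g (nv .k) 0) : Prog).run σ).1 :=
    h.map_loop _ fun _ _ _ _ _ => Nat.cast_zero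
  have hf := Cmd.run_frame (.forTo .k dim (.put .g (nv .k) 0) : Prog) σ
  replace h := h.of_frame hf
  replace hx := hx.of_frame hf
  replace hw := hw.of_frame hf
  generalize ((Cmd.forTo .k dim (.put .g (nv .k) 0) : Prog).run σ).1 = σ at *
  -- Extending the sample terms by zero to all of ℕ turns partial gradients into sums over
  -- `Finset.range k`, the form needed for the invariant.
  let F : ℕ → LiftedCoord n → ℝ := fun m c => if hm : m < N then gradientTerm lam z i w ⟨m, hm⟩
      * liftSample (2 * lam) (nodeFeature i (z ⟨m, hm⟩)) c else 0
  have hg₂ : Holds .g (fun c => ∑ m ∈ Finset.range N, F m c)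
      ((Cmd.forTo .m (nv .N) gradientStep).run σ).1 := by
    let P : ℕ → Memory NReg RReg Arr → Prop := fun k s =>
      Holds .g (fun c => ∑ m ∈ Finset.range k, F m c) s
    refine Cmd.forTo_induction P h.nat_N (fun _ _ _ h => h) hg₁ fun k hk s hf hm ih => ?_
    have := gradientStep_run (m := ⟨k, hk⟩) (h.of_frame hf) (hx.of_frame hf) hm ih
      (hw.of_frame hf)
    intro c
    rw [this c]
    simp only [Finset.sum_range_succ, F, dif_pos hk]
  have hf := Cmd.run_frame (.forTo .m (nv .N) gradientStep) σ
  replace h := h.of_frame hf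
  generalize ((Cmd.forTo .m (nv .N) gradientStep).run σ).1 = σ at *
  refine h.map_loop _ fun c s hf hs hc => ?_
  change s.arr .g (s.nat .k) / (s.nat .N : ℝ) = _
  rw [hs, hc, hg₂ c, (h.of_frame hf).nat_N, mdGradient]
  simp only [Finset.sum_range, F, Fin.is_lt, dif_pos, gradientTerm]
  rw [one_div, div_eq_inv_mul]

theorem update_run {g w : LiftedCoord n → ℝ} (h : Ready T lam eta z σ)
    (hg : Holds .g g σ) (hw : Holds .w w σ) :
    Holds .w (mdUpdate (σ.real .gam) g w) (update.run σ).1 := by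
  have hr : (update.run σ).1 = ((Cmd.forTo .k dim
      (.put .w (nv .k) (cell .w (nv .k) / rv .total)) : Prog).run
      ((Cmd.forTo .k dim (.setReal .total (rv .total + .abs (cell .w (nv .k)))) : Prog).run
      ((Cmd.setReal .total 0 : Prog).run ((Cmd.forTo .k dim (.put .w (nv .k)
      (cell .w (nv .k) * .exp (-rv .gam * cell .g (nv .k)))) : Prog).run σ).1).1).1).1 := rfl
  rw [hr]
  have hw₁ : Holds .w (fun c => w c * Real.exp (-σ.real .gam * g c)) ((Cmd.forTo .k dim
      (.put .w (nv .k) (cell .w (nv .k) * .exp (-rv .gam * cell .g (nv .k)))) : Prog).run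
      σ).1 := by
    refine h.map_loop _ fun c s hf hs hc => ?_
    change s.arr .w (s.nat .k) * Real.exp (-s.real .gam * s.arr .g (s.nat .k)) = _
    rw [hs, hc, hw c, hf.real .gam rfl, hf.arr .g rfl, hg c]
  replace h := h.of_frame (Cmd.run_frame (.forTo .k dim (.put .w (nv .k)
    (cell .w (nv .k) * .exp (-rv .gam * cell .g (nv .k)))) : Prog) σ)
  generalize ((Cmd.forTo .k dim (.put .w (nv .k)
      (cell .w (nv .k) * .exp (-rv .gam * cell .g (nv .k)))) : Prog).run σ).1 = σ' at *
  have hs₁ : ((Cmd.setReal .total 0 : Prog).run σ').1.real .total = 0 := by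
    rw [Cmd.run_setReal_real]
    exact Nat.cast_zero
  have hf := Cmd.run_frame (.setReal .total 0 : Prog) σ'
  replace h := h.of_frame hf
  replace hw₁ := hw₁.of_frame hf
  generalize ((Cmd.setReal .total 0 : Prog).run σ').1 = σ' at *
  have hs₂ : ((Cmd.forTo .k dim (.setReal .total (rv .total + .abs (cell .w (nv .k)))) :
      Prog).run σ').1.real .total = ∑ c, |w c * Real.exp (-σ.real .gam * g c)| := by
    refine (Cmd.run_sum_loop (fun k => |σ'.arr .w k|) h.eval_dim fun k hk s hf hs => ?_).trans ?_
    · change |s.arr .w (s.nat .k)| = _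
      rw [hf.arr .w rfl, hs]
    · rw [hs₁, zero_add]
      exact sum_range_eq_sum_lifted fun c => by rw [hw₁ c]
  have hf := Cmd.run_frame
    (.forTo .k dim (.setReal .total (rv .total + .abs (cell .w (nv .k)))) : Prog) σ'
  replace h := h.of_frame hf
  replace hw₁ := hw₁.of_frame hf
  generalize ((Cmd.forTo .k dim (.setReal .total (rv .total + .abs (cell .w (nv .k)))) :
      Prog).run σ').1 = σ' at *
  refine h.map_loop _ fun c s hf hs hc => ?_
  change s.arr .w (s.nat .k) / s.real .total = _
  rw [hs, hc, hw₁ c, hf.real .total rfl, hs₂, mdUpdate]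

/-- One iteration of mirror descent. -/
abbrev descentStep : Prog := accumulate ;; gradient ;; update

/-- The regression for one node, without forming the samples. -/
theorem descent_run {i : Fin n} (h : Ready T lam eta z σ) (hx : Formed lam z i N σ)
    (hw : Holds (n := n) .w (fun _ => 1 / (2 * n + 1)) σ)
    (ha : Holds (n := n) .acc (fun _ => 0) σ)
    (hg : σ.real .gam = mdStepSize n (2 * lam) T) :
    Holds .acc (fun c => ∑ t ∈ Finset.range T, mdIterate (2 * lam) T
      (fun m => nodeFeature i (z m)) (fun m => spin (z m i)) t c)
      ((Cmd.forTo .t (nv .T) descentStep).run σ).1 := by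
  let u := mdIterate (2 * lam) T (fun m => nodeFeature i (z m)) (fun m => spin (z m i))
  -- Accumulation precedes the update: after k rounds `acc` holds the sum of iterates 0, …, k-1
  -- while `w` already holds iterate k.
  let P : ℕ → Memory NReg RReg Arr → Prop := fun k s =>
    Holds .w (u k) s ∧ Holds .acc (fun c => ∑ t ∈ Finset.range k, u t c) s
  suffices hP : P T ((Cmd.forTo .t (nv .T) descentStep).run σ).1 from hP.2
  refine Cmd.forTo_induction P h.nat_T (fun _ _ _ h => h)
    ⟨hw, fun c => by rw [ha c]; simp only [Finset.sum_range_zero]⟩ fun k hk s hf hk ⟨hw, ha⟩ => ?_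
  rw [Cmd.run_seq, Cmd.run_seq]
  have hr := h.of_frame hf
  have hx := hx.of_frame hf
  have hg := (hf.real .gam rfl).trans hg
  have ha₁ := accumulate_run hr ha hw
  have hf₁ := Cmd.run_frame accumulate s
  replace hr := hr.of_frame hf₁
  have hg₂ := gradient_run hr (hx.of_frame hf₁) (hw.of_frame hf₁)
  have hf₂ := Cmd.run_frame gradient (accumulate.run s).1
  have hw₃ := update_run (hr.of_frame hf₂) hg₂ ((hw.of_frame hf₁).of_frame hf₂)
  rw [hf₂.real .gam rfl, hf₁.real .gam rfl, hg] at hw₃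
  refine ⟨hw₃, fun c => ?_⟩
  have hf₃ := Cmd.run_frame update (gradient.run (accumulate.run s).1).1
  rw [((ha₁.of_frame hf₂).of_frame hf₃) c]
  simp only [Finset.sum_range_succ]

/-- As for the samples, the first conjunct says that earlier rows of the output survive. -/
theorem writeRow_run {i : Fin n} {v : LiftedCoord n → ℝ} (h : Ready T lam eta z σ)
    (hi : σ.nat .i = i) (ha : Holds .acc v σ) :
    (∀ l < (i : ℕ) * n, (writeRow.run σ).1.arr .Ahat l = σ.arr .Ahat l) ∧
    ∀ j : Fin n, (writeRow.run σ).1.arr .Ahat (i * n + j) = if j = i then 0 else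
      (v (.inl (.inl j)) / T - v (.inl (.inr j)) / T) * (2 * lam) / 2 := by
  set p : Prog := .forTo .k dim (.put .acc (nv .k) (cell .acc (nv .k) / .cast (nv .T)))
  set q : Prog := .ite (.natEq (nv .j) (nv .i))
      (.put .Ahat (nv .i * nv .n + nv .j) 0)
      (.put .Ahat (nv .i * nv .n + nv .j)
        ((cell .acc (nv .j) - cell .acc (nv .n + nv .j)) * rv .W / 2)) with hq
  have hrun : (writeRow.run σ).1 = ((Cmd.forTo .j (nv .n) q).run (p.run σ).1).1 := rfl
  rw [hrun]
  have ha₁ : Holds .acc (fun c => v c / T) (p.run σ).1 := by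
    refine h.map_loop _ fun c s hf hs hc => ?_
    change s.arr .acc (s.nat .k) / ((s.nat .T : ℕ) : ℝ) = _
    rw [hs, hc, ha c, (h.of_frame hf).nat_T]
  have hf := Cmd.run_frame p σ
  rw [← hf.arr .Ahat rfl]
  replace h := h.of_frame hf
  replace hi := (hf.nat .i rfl).trans hi
  clear hrun hf ha
  generalize (p.run σ).1 = σ at *
  let u : Fin n → ℝ := fun j => if j = i then 0 else
    (v (.inl (.inl j)) / T - v (.inl (.inr j)) / T) * (2 * lam) / 2
  let P : ℕ → Memory NReg RReg Arr → Prop := fun k s =>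
    (∀ l < (i : ℕ) * n, s.arr .Ahat l = σ.arr .Ahat l) ∧
    ∀ j : Fin n, (j : ℕ) < k → s.arr .Ahat (i * n + j) = u j
  suffices hP : P n ((Cmd.forTo .j (nv .n) q).run σ).1 from ⟨hP.1, fun j => hP.2 j j.isLt⟩
  refine Cmd.forTo_induction P h.nat_n (fun _ _ _ h => h)
    ⟨fun _ _ => rfl, fun _ hj => by omega⟩ fun k hk s hf hj ⟨h₁, h₂⟩ => ?_
  have hr := h.of_frame hf
  replace hi := (hf.nat .i rfl).trans hi
  replace ha₁ := ha₁.of_frame hf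
  have hrun : (q.run s).1.arr .Ahat
      = Function.update (s.arr .Ahat) (i * n + k) (u ⟨k, hk⟩) := by
    have hidx : (nv .i * nv .n + nv .j).eval s = i * n + k := by
      change s.nat .i * s.nat .n + s.nat .j = _
      rw [hi, hj, hr.nat_n]
    by_cases hik : k = i
    · have hb : (Test.natEq (nv .j) (nv .i) : Test NReg RReg Arr).Holds s := by
        change s.nat .j = s.nat .i
        rw [hi, hj, hik]
      rw [hq, Cmd.run_ite_pos hb, Cmd.run_put_arr, hidx]
      congr 1
      simp only [u, if_pos (show (⟨k, hk⟩ : Fin n) = i from Fin.ext hik)]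
      exact Nat.cast_zero
    · have hb : ¬ (Test.natEq (nv .j) (nv .i) : Test NReg RReg Arr).Holds s := by
        change ¬ s.nat .j = s.nat .i
        rwa [hi, hj]
      rw [hq, Cmd.run_ite_neg hb, Cmd.run_put_arr, hidx]
      congr 1
      simp only [u, if_neg (show (⟨k, hk⟩ : Fin n) ≠ i from fun h => hik (congrArg Fin.val h))]
      change (s.arr .acc (s.nat .j) - s.arr .acc (s.nat .n + s.nat .j)) * s.real .W
        / ((2 : ℕ) : ℝ) = _
      rw [hj, hr.nat_n, hr.real_W]
      have h₃ := ha₁ (.inl (.inl ⟨k, hk⟩))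
      have h₄ := ha₁ (.inl (.inr ⟨k, hk⟩))
      simp only [liftIndex, Sum.elim_inl, Sum.elim_inr] at h₃ h₄
      rw [h₃, h₄, Nat.cast_ofNat]
  refine ⟨fun l hl => ?_, fun j hj => ?_⟩
  · rw [hrun, Function.update_of_ne (by omega), h₁ l hl]
  · rw [hrun]
    rcases Nat.lt_succ_iff_lt_or_eq.mp hj with hlt | heq
    · rw [Function.update_of_ne (by omega), h₂ j hlt]
    · obtain rfl : j = ⟨k, hk⟩ := Fin.ext heq
      simp

/-- The part of the program that computes one row of the estimate. -/
abbrev learnRow : Prog :=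
  formSamples ;; setUp ;; .forTo .t (nv .T) (accumulate ;; gradient ;; update) ;; writeRow

theorem learnRow_run {i : Fin n} (h : Ready T lam eta z σ) (hi : σ.nat .i = i) :
    (∀ l < (i : ℕ) * n, (learnRow.run σ).1.arr .Ahat l = σ.arr .Ahat l) ∧
    ∀ j : Fin n, (learnRow.run σ).1.arr .Ahat (i * n + j) = isingEstimate lam T z i j := by
  rw [Cmd.run_seq, Cmd.run_seq, Cmd.run_seq]
  have hx := formSamples_run h hi
  have hf := Cmd.run_frame formSamples σ
  rw [← hf.arr .Ahat rfl]
  replace h := h.of_frame hf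
  replace hi := (hf.nat .i rfl).trans hi
  generalize (formSamples.run σ).1 = σ at *
  obtain ⟨hw, ha, hg⟩ := setUp_run h
  have hf := Cmd.run_frame setUp σ
  rw [← hf.arr .Ahat rfl]
  replace h := h.of_frame hf
  replace hx := hx.of_frame hf
  replace hi := (hf.nat .i rfl).trans hi
  generalize (setUp.run σ).1 = σ at *
  have hacc := descent_run h hx hw ha hg
  have hf := Cmd.run_frame (.forTo .t (nv .T) (accumulate ;; gradient ;; update)) σ
  rw [← hf.arr .Ahat rfl]
  obtain ⟨h₁, h₂⟩ := writeRow_run (h.of_frame hf) ((hf.nat .i rfl).trans hi) hacc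
  exact ⟨h₁, h₂⟩

theorem learnRows_run (h : Ready T lam eta z σ) (i j : Fin n) :
    ((Cmd.forTo .i (nv .n) learnRow).run σ).1.arr .Ahat (i * n + j)
      = isingEstimate lam T z i j := by
  let P : ℕ → Memory NReg RReg Arr → Prop := fun k s =>
    ∀ i : Fin n, (i : ℕ) < k → ∀ j : Fin n, s.arr .Ahat (i * n + j) = isingEstimate lam T z i j
  suffices hP : P n ((Cmd.forTo .i (nv .n) learnRow).run σ).1 from hP i i.isLt j
  refine Cmd.forTo_induction P h.nat_n (fun _ _ _ h => h) (fun _ hi => by omega)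
    fun k hk s hf hks ih => ?_
  obtain ⟨h₁, h₂⟩ := learnRow_run (i := ⟨k, hk⟩) (h.of_frame hf) hks
  intro i hi j
  rcases Nat.lt_succ_iff_lt_or_eq.mp hi with hlt | heq
  · have hle : (i : ℕ) * n + n ≤ k * n := by
      rw [← Nat.succ_mul]
      exact Nat.mul_le_mul_right _ hlt
    rw [h₁ _ (by have := j.isLt; simp only; omega)]
    exact ih i hlt j
  · obtain rfl : i = ⟨k, hk⟩ := Fin.ext heq
    exact h₂ j

/-- Writes one entry of the adjacency matrix. -/
abbrev writeEdge : Prog :=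
  .ite (.natLt (nv .i) (nv .j))
    (.setNat .k (nv .i * nv .n + nv .j))
    (.setNat .k (nv .j * nv .n + nv .i)) ;;
  .ite (.natEq (nv .i) (nv .j))
    (.put .edge (nv .i * nv .n + nv .j) 0)
    (.ite (.realLe (rv .eta / 2) (.abs (cell .Ahat (nv .k))))
      (.put .edge (nv .i * nv .n + nv .j) 1)
      (.put .edge (nv .i * nv .n + nv .j) 0))

open Classical in
/-- The entries of the adjacency matrix of the estimated graph. -/
noncomputable def edgeValue (lam eta : ℝ) (T : ℕ) (z : Fin N → Fin n → ℤˣ) (i j : Fin n) : ℝ :=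
  if (isingGraphEstimate lam eta T z).Adj i j then 1 else 0

/-- Register `k` receives the address of the above-diagonal entry of the pair, so (i,j) and (j,i)
test the same number. This matches the symmetrization in `SimpleGraph.fromRel`, since Â itself need
not be symmetric. -/
theorem writeEdge_run {i j : Fin n} (h : Ready T lam eta z σ)
    (hA : ∀ i j : Fin n, σ.arr .Ahat (i * n + j) = isingEstimate lam T z i j)
    (hi : σ.nat .i = i) (hj : σ.nat .j = j) :
    (writeEdge.run σ).1.arr .edge
      = Function.update (σ.arr .edge) (i * n + j) (edgeValue lam eta T z i j) := by
  rw [Cmd.run_seq]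
  set p : Prog := .ite (.natLt (nv .i) (nv .j))
    (.setNat .k (nv .i * nv .n + nv .j))
    (.setNat .k (nv .j * nv .n + nv .i)) with hp
  have hk : (p.run σ).1.nat .k = if i < j then (i : ℕ) * n + j else j * n + i := by
    by_cases hij : i < j
    · have hb : (Test.natLt (nv .i) (nv .j) : Test NReg RReg Arr).Holds σ := by
        change σ.nat .i < σ.nat .j
        rwa [hi, hj]
      rw [hp, Cmd.run_ite_pos hb, Cmd.run_setNat_nat, if_pos hij]
      change σ.nat .i * σ.nat .n + σ.nat .j = _
      rw [hi, hj, h.nat_n]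
    · have hb : ¬ (Test.natLt (nv .i) (nv .j) : Test NReg RReg Arr).Holds σ := by
        change ¬ σ.nat .i < σ.nat .j
        rwa [hi, hj]
      rw [hp, Cmd.run_ite_neg hb, Cmd.run_setNat_nat, if_neg hij]
      change σ.nat .j * σ.nat .n + σ.nat .i = _
      rw [hi, hj, h.nat_n]
  have hf := Cmd.run_frame p σ
  rw [← hf.arr .edge rfl]
  rw [← hf.arr .Ahat rfl] at hA
  replace h := h.of_frame hf
  replace hi := (hf.nat .i rfl).trans hi
  replace hj := (hf.nat .j rfl).trans hj
  generalize (p.run σ).1 = σ at *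
  have hidx : (nv .i * nv .n + nv .j).eval σ = i * n + j := by
    change σ.nat .i * σ.nat .n + σ.nat .j = _
    rw [hi, hj, h.nat_n]
  have hzero : (0 : RExp NReg RReg Arr).eval σ = 0 := Nat.cast_zero
  have hone : (1 : RExp NReg RReg Arr).eval σ = 1 := Nat.cast_one
  have hadj : (isingGraphEstimate lam eta T z).Adj i j ↔ i ≠ j ∧
      eta / 2 ≤ |σ.arr .Ahat (σ.nat .k)| := by
    rw [isingGraphEstimate, SimpleGraph.fromRel_adj]
    refine and_congr_right fun hne => ?_
    rcases lt_or_gt_of_ne hne with hlt | hlt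
    · simp [hk, hlt, hlt.not_gt, hA]
    · simp [hk, hlt, hlt.not_gt, hA]
  by_cases hij : i = j
  · have hb : (Test.natEq (nv .i) (nv .j) : Test NReg RReg Arr).Holds σ := by
      change σ.nat .i = σ.nat .j
      rw [hi, hj, hij]
    rw [Cmd.run_ite_pos hb, Cmd.run_put_arr, hidx, hzero, edgeValue,
      if_neg (fun h => (hadj.1 h).1 hij)]
  · have hb : ¬ (Test.natEq (nv .i) (nv .j) : Test NReg RReg Arr).Holds σ := by
      change ¬ σ.nat .i = σ.nat .j
      rw [hi, hj]
      exact fun h => hij (Fin.ext h)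
    rw [Cmd.run_ite_neg hb]
    have hle : (Test.realLe (rv .eta / 2) (.abs (cell .Ahat (nv .k))) :
        Test NReg RReg Arr).Holds σ ↔ eta / 2 ≤ |σ.arr .Ahat (σ.nat .k)| := by
      change σ.real .eta / ((2 : ℕ) : ℝ) ≤ |σ.arr .Ahat (σ.nat .k)| ↔ _
      rw [h.real_eta, Nat.cast_ofNat]
    by_cases hc : eta / 2 ≤ |σ.arr .Ahat (σ.nat .k)|
    · rw [Cmd.run_ite_pos (hle.2 hc), Cmd.run_put_arr, hidx, hone, edgeValue,
        if_pos (hadj.2 ⟨hij, hc⟩)]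
    · rw [Cmd.run_ite_neg (fun h => hc (hle.1 h)), Cmd.run_put_arr, hidx, hzero, edgeValue,
        if_neg (fun h => hc (hadj.1 h).2)]

theorem writeEdges_run {i : Fin n} (h : Ready T lam eta z σ)
    (hA : ∀ i j : Fin n, σ.arr .Ahat (i * n + j) = isingEstimate lam T z i j)
    (hi : σ.nat .i = i) :
    (∀ l < (i : ℕ) * n,
      ((Cmd.forTo .j (nv .n) writeEdge).run σ).1.arr .edge l = σ.arr .edge l) ∧
    ∀ j : Fin n, ((Cmd.forTo .j (nv .n) writeEdge).run σ).1.arr .edge (i * n + j)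
      = edgeValue lam eta T z i j := by
  let P : ℕ → Memory NReg RReg Arr → Prop := fun k s =>
    (∀ l < (i : ℕ) * n, s.arr .edge l = σ.arr .edge l) ∧
    ∀ j : Fin n, (j : ℕ) < k → s.arr .edge (i * n + j) = edgeValue lam eta T z i j
  suffices hP : P n ((Cmd.forTo .j (nv .n) writeEdge).run σ).1 from
    ⟨hP.1, fun j => hP.2 j j.isLt⟩
  refine Cmd.forTo_induction P h.nat_n (fun _ _ _ h => h)
    ⟨fun _ _ => rfl, fun _ hj => by omega⟩ fun k hk s hf hj ⟨h₁, h₂⟩ => ?_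
  have hrun := writeEdge_run (j := ⟨k, hk⟩) (h.of_frame hf)
    (by rw [hf.arr .Ahat rfl]; exact hA) ((hf.nat .i rfl).trans hi) hj
  refine ⟨fun l hl => ?_, fun j hj => ?_⟩
  · rw [hrun, Function.update_of_ne (by omega), h₁ l hl]
  · rw [hrun]
    rcases Nat.lt_succ_iff_lt_or_eq.mp hj with hlt | heq
    · rw [Function.update_of_ne (by simp only; omega), h₂ j hlt]
    · obtain rfl : j = ⟨k, hk⟩ := Fin.ext heq
      simp

theorem writeGraph_run (h : Ready T lam eta z σ)
    (hA : ∀ i j : Fin n, σ.arr .Ahat (i * n + j) = isingEstimate lam T z i j) (i j : Fin n) :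
    (writeGraph.run σ).1.arr .edge (i * n + j) = edgeValue lam eta T z i j := by
  let P : ℕ → Memory NReg RReg Arr → Prop := fun k s =>
    ∀ i : Fin n, (i : ℕ) < k → ∀ j : Fin n, s.arr .edge (i * n + j) = edgeValue lam eta T z i j
  suffices hP : P n ((Cmd.forTo .i (nv .n) (.forTo .j (nv .n) writeEdge)).run σ).1 from
    hP i i.isLt j
  refine Cmd.forTo_induction P h.nat_n (fun _ _ _ h => h) (fun _ hi => by omega)
    fun k hk s hf hks ih => ?_
  obtain ⟨h₁, h₂⟩ := writeEdges_run (i := ⟨k, hk⟩) (h.of_frame hf)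
    (by rw [hf.arr .Ahat rfl]; exact hA) hks
  intro i hi j
  rcases Nat.lt_succ_iff_lt_or_eq.mp hi with hlt | heq
  · have hle : (i : ℕ) * n + n ≤ k * n := by
      rw [← Nat.succ_mul]
      exact Nat.mul_le_mul_right _ hlt
    rw [h₁ _ (by have := j.isLt; simp only; omega)]
    exact ih i hlt j
  · obtain rfl : i = ⟨k, hk⟩ := Fin.ext heq
    exact h₂ j

theorem input_arr_z (m : Fin N) (j : Fin n) :
    (input T lam eta z).arr .z (m * n + j) = spin (z m j) := by
  have hlt : (m : ℕ) * n + j < N * n := by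
    have hle : (m : ℕ) * n + n ≤ N * n := by
      rw [← Nat.succ_mul]
      exact Nat.mul_le_mul_right _ m.isLt
    have := j.isLt
    omega
  have hinv : finProdFinEquiv.symm ⟨(m : ℕ) * n + j, hlt⟩ = (m, j) := by
    rw [Equiv.symm_apply_eq]
    ext
    simp [finProdFinEquiv, mul_comm, add_comm]
  simp only [input, dif_pos hlt, hinv]

theorem ready_setReal_input :
    Ready T lam eta z ((Cmd.setReal .W (2 * rv .lam) : Prog).run (input T lam eta z)).1 where
  nat_n := rfl
  nat_N := rfl
  nat_T := rfl
  real_W := by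
    rw [Cmd.run_setReal_real]
    change ((2 : ℕ) : ℝ) * lam = _
    rw [Nat.cast_ofNat]
  real_eta := rfl
  arr_z := input_arr_z (T := T) (lam := lam) (eta := eta)

theorem output_correct (i j : Fin n) :
    (output T lam eta z).arr .Ahat (i * n + j) = isingEstimate lam T z i j ∧
    (output T lam eta z).arr .edge (i * n + j) = edgeValue lam eta T z i j := by
  have hout : output T lam eta z = (writeGraph.run ((Cmd.forTo .i (nv .n) learnRow).run
      ((Cmd.setReal .W (2 * rv .lam) : Prog).run (input T lam eta z)).1).1).1 := rfl
  have h := ready_setReal_input (T := T) (lam := lam) (eta := eta) (z := z)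
  have hA := learnRows_run h
  replace h := h.of_frame (Cmd.run_frame (.forTo .i (nv .n) learnRow) _)
  rw [hout]
  exact ⟨by rw [(Cmd.run_frame writeGraph _).arr .Ahat rfl, hA], writeGraph_run h hA i j⟩

end

end IsingProgram

/-! ### Static cost bounds and the running time of the program. -/

namespace RealRAM

section

variable {I R A : Type}

theorem RExp.cost_sub (a b : RExp I R A) : (a - b).cost = a.cost + b.cost + 1 := rfl

theorem RExp.cost_div (a b : RExp I R A) : (a / b).cost = a.cost + b.cost + 1 := rfl

/-- Whether an index expression mentions only registers from a given set. -/
def NExp.over (S : I → Bool) : NExp I → Bool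
  | .lit _ => true
  | .var x => S x
  | .add a b => a.over S && b.over S
  | .mul a b => a.over S && b.over S

/-- Whether all loop bounds are determined by registers from a given set, which are never
assigned to. -/
def Cmd.steady (S : I → Bool) : Cmd I R A → Bool
  | .setNat x _ => !S x
  | .setReal _ _ => true
  | .put _ _ _ => true
  | .seq p q => p.steady S && q.steady S
  | .ite _ p q => p.steady S && q.steady S
  | .forTo x e p => !S x && e.over S && p.steady S

/-- A bound on the cost that reads all loop bounds off a given memory. -/
def Cmd.costBound (σ : Memory I R A) : Cmd I R A → ℕ
  | .setNat _ e => e.cost + 1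
  | .setReal _ e => e.cost + 1
  | .put _ k e => k.cost + e.cost + 1
  | .seq p q => p.costBound σ + q.costBound σ
  | .ite b p q => p.costBound σ + q.costBound σ + b.cost
  | .forTo _ e p => e.eval σ * (p.costBound σ + 1) + e.cost + 1

theorem NExp.eval_congr {S : I → Bool} {e : NExp I} (he : e.over S = true)
    {σ τ : Memory I R A} (h : ∀ y, S y = true → τ.nat y = σ.nat y) : e.eval τ = e.eval σ := by
  induction e with
  | lit k => rfl
  | var x => exact h x he
  | add a b iha ihb | mul a b iha ihb =>
    simp only [NExp.over, Bool.and_eq_true] at he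
    simp only [NExp.eval, iha he.1, ihb he.2]

variable [DecidableEq I] [DecidableEq R] [DecidableEq A]

theorem Cmd.run_nat_of_steady {S : I → Bool} {p : Cmd I R A} (hp : p.steady S = true)
    (σ : Memory I R A) {y : I} (hy : S y = true) : (p.run σ).1.nat y = σ.nat y := by
  refine (Cmd.run_frame p σ).nat y ?_
  induction p with
  | setNat x e =>
    have : x ≠ y := by
      rintro rfl
      simp [Cmd.steady, hy] at hp
    simpa [Cmd.writesNat] using this
  | setReal x e => rfl
  | put a k e => rfl
  | seq p q ihp ihq | ite b p q ihp ihq =>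
    simp only [Cmd.steady, Bool.and_eq_true] at hp
    simp [Cmd.writesNat, ihp hp.1, ihq hp.2]
  | forTo x e p ih =>
    simp only [Cmd.steady, Bool.and_eq_true, Bool.not_eq_true'] at hp
    have : x ≠ y := by
      rintro rfl
      simp [hy] at hp
    simp [Cmd.writesNat, ih hp.2, this]

/-- Registers in S keep their values throughout, so each loop bound evaluates as it does in σ
whenever the loop is entered. A conditional is charged for both branches, which makes the bound
independent of the data. -/
theorem Cmd.cost_le_costBound {S : I → Bool} {p : Cmd I R A} (hp : p.steady S = true)
    {σ τ : Memory I R A} (h : ∀ y, S y = true → τ.nat y = σ.nat y) :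
    (p.run τ).2 ≤ p.costBound σ := by
  induction p generalizing τ with
  | setNat x e => exact le_rfl
  | setReal x e => exact le_rfl
  | put a k e => exact le_rfl
  | seq p q ihp ihq =>
    simp only [Cmd.steady, Bool.and_eq_true] at hp
    exact add_le_add (ihp hp.1 h)
      (ihq hp.2 fun y hy => (Cmd.run_nat_of_steady hp.1 τ hy).trans (h y hy))
  | ite b p q ihp ihq =>
    simp only [Cmd.steady, Bool.and_eq_true] at hp
    simp only [Cmd.run, Cmd.costBound]
    split_ifs
    · have := ihp hp.1 h
      omega
    · have := ihq hp.2 h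
      omega
  | forTo x e p ih =>
    simp only [Cmd.steady, Bool.and_eq_true, Bool.not_eq_true'] at hp
    obtain ⟨⟨hx, he⟩, hp⟩ := hp
    simp only [Cmd.run, Cmd.costBound, NExp.eval_congr he h]
    -- The constancy of the S-registers must be proved alongside the cost, because each pass starts
    -- from the memory left by the previous one.
    have key : ∀ K, (∀ y, S y = true → (loop (fun k υ => p.run
        { υ with nat := Function.update υ.nat x k }) K τ).1.nat y = σ.nat y) ∧
        (loop (fun k υ => p.run { υ with nat := Function.update υ.nat x k }) K τ).2
          ≤ K * (p.costBound σ + 1) := by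
      intro K
      induction K with
      | zero => exact ⟨h, by simp [loop]⟩
      | succ K ihK =>
        simp only [loop]
        generalize loop (fun k υ => p.run
          { υ with nat := Function.update υ.nat x k }) K τ = υ at *
        have hυ : ∀ y, S y = true → Function.update υ.1.nat x K y = σ.nat y := by
          intro y hy
          have : y ≠ x := by
            rintro rfl
            simp [hy] at hx
          rw [Function.update_of_ne this, ihK.1 y hy]
        refine ⟨fun y hy => (Cmd.run_nat_of_steady hp _ hy).trans (hυ y hy), ?_⟩
        rw [Nat.succ_mul]
        exact (add_le_add (add_le_add ihK.2 (ih hp hυ)) (le_refl 1)).trans (by omega)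
    have := (key (e.eval σ)).2
    omega

end

end RealRAM

namespace IsingProgram

open RealRAM

/-- Whether a register holds one of the sizes of the input. -/
def isSize : NReg → Bool
  | .n => true
  | .N => true
  | .T => true
  | _ => false

theorem steps_le {n N T : ℕ} (lam eta : ℝ) (z : Fin N → Fin n → ℤˣ) (hn : 1 ≤ n)
    (hN : 1 ≤ N) (hT : 1 ≤ T) : steps T lam eta z ≤ 2000 * (T * N * n ^ 2) := by
  refine (Cmd.cost_le_costBound (S := isSize) rfl (σ := input T lam eta z)
    fun _ _ => rfl).trans ?_
  -- After shifting n, N, T by 1, both sides are polynomials in a, b, c with natural coefficients.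
  -- The claim then holds coefficientwise, and `omega` proves it with the monomials as atoms; 2000
  -- is a generous constant.
  obtain ⟨a, rfl⟩ := Nat.exists_eq_add_of_le hn
  obtain ⟨b, rfl⟩ := Nat.exists_eq_add_of_le hN
  obtain ⟨c, rfl⟩ := Nat.exists_eq_add_of_le hT
  have hdim : dim.eval (input (1 + c) lam eta z) = 2 * (1 + a) + 1 := rfl
  have hn' : (nv .n).eval (input (1 + c) lam eta z) = 1 + a := rfl
  have hN' : (nv .N).eval (input (1 + c) lam eta z) = 1 + b := rfl
  have hT' : (nv .T).eval (input (1 + c) lam eta z) = 1 + c := rfl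
  simp only [learnIsing, formSamples, setUp, accumulate, gradient, update, writeRow, writeGraph,
    Cmd.costBound, hdim, hn', hN', hT', NExp.cost, RExp.cost, RExp.cost_sub, RExp.cost_div,
    Test.cost]
  ring_nf
  omega

end IsingProgram

/-! ### Exponentiated gradient and its regret. -/

/-- Hoeffding's lemma for a finite probability vector. -/
theorem sum_mul_exp_neg_le {ι : Type*} [Fintype ι] {w g : ι → ℝ} (hw : ∀ c, 0 ≤ w c)
    (hsum : ∑ c, w c = 1) {G : ℝ} (hg : ∀ c, |g c| ≤ G) (γ : ℝ) :
    ∑ c, w c * Real.exp (-γ * g c)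
      ≤ Real.exp (-γ * (∑ c, g c * w c) + γ ^ 2 * G ^ 2 / 2) := by
  let _ : MeasurableSpace ι := ⊤
  have : DiscreteMeasurableSpace ι := ⟨fun _ => trivial⟩
  let p : PMF ι := PMF.ofFintype (fun c => ENNReal.ofReal (w c)) (by
    rw [← ENNReal.ofReal_sum_of_nonneg fun c _ => hw c, hsum, ENNReal.ofReal_one])
  have hp : ∀ c, (p c).toReal = w c := fun c => ENNReal.toReal_ofReal (hw c)
  have hsub := ProbabilityTheory.hasSubgaussianMGF_of_mem_Icc (μ := p.toMeasure) (X := g)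
    (a := -G) (b := G) (Measurable.of_discrete.aemeasurable)
    (Filter.Eventually.of_forall fun c => abs_le.1 (hg c))
  have hmgf := hsub.mgf_le (-γ)
  have hmean : ∫ c, g c ∂p.toMeasure = ∑ c, g c * w c := by
    simp [PMF.integral_eq_sum, hp, mul_comm]
  have hG : ((((‖G - -G‖₊ / 2) ^ 2 : NNReal)) : ℝ) = G ^ 2 := by
    simp only [NNReal.coe_pow, NNReal.coe_div, coe_nnnorm, Real.norm_eq_abs, NNReal.coe_ofNat,
      div_pow, sq_abs]
    ring
  rw [ProbabilityTheory.mgf, PMF.integral_eq_sum, hmean, hG] at hmgf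
  set M := ∑ c, g c * w c
  -- Factoring out the mean leaves the moment generating function of the centred variable, which the
  -- sub-Gaussian bound controls.
  have hsplit : ∑ c, w c * Real.exp (-γ * g c)
      = Real.exp (-γ * M) * ∑ c, (p c).toReal • Real.exp (-γ * (g c - M)) := by
    rw [Finset.mul_sum]
    refine Finset.sum_congr rfl fun c _ => ?_
    rw [hp, smul_eq_mul, mul_left_comm, ← Real.exp_add]
    congr 2
    ring
  rw [hsplit, Real.exp_add]
  refine mul_le_mul_of_nonneg_left (hmgf.trans_eq ?_) (Real.exp_pos _).le
  congr 1
  ring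

section

variable {n : ℕ}

theorem mdUpdate_eq {γ : ℝ} {g w : LiftedCoord n → ℝ} (hw : ∀ c, 0 < w c)
    (c : LiftedCoord n) : mdUpdate γ g w c
      = w c * Real.exp (-γ * g c) / ∑ c', w c' * Real.exp (-γ * g c') := by
  rw [mdUpdate]
  congr 1
  exact Finset.sum_congr rfl fun c' _ => abs_of_pos (mul_pos (hw c') (Real.exp_pos _))

theorem normalizer_pos {γ : ℝ} {g w : LiftedCoord n → ℝ} (hw : ∀ c, 0 < w c) :
    0 < ∑ c', w c' * Real.exp (-γ * g c') :=
  Finset.sum_pos (fun c _ => mul_pos (hw c) (Real.exp_pos _)) Finset.univ_nonempty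

theorem mdUpdate_pos {γ : ℝ} {g w : LiftedCoord n → ℝ} (hw : ∀ c, 0 < w c)
    (c : LiftedCoord n) : 0 < mdUpdate γ g w c := by
  rw [mdUpdate_eq hw]
  exact div_pos (mul_pos (hw c) (Real.exp_pos _)) (normalizer_pos hw)

theorem sum_mdUpdate {γ : ℝ} {g w : LiftedCoord n → ℝ} (hw : ∀ c, 0 < w c) :
    ∑ c, mdUpdate γ g w c = 1 := by
  simp only [mdUpdate_eq hw, ← Finset.sum_div]
  exact div_self (normalizer_pos hw).ne'

theorem card_liftedCoord : (Fintype.card (LiftedCoord n) : ℝ) = 2 * n + 1 := by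
  simp [two_mul]

/-- The potential argument for one step of exponentiated gradient. -/
theorem mdUpdate_potential {γ G : ℝ} {g w u : LiftedCoord n → ℝ} (hw : ∀ c, 0 < w c)
    (hw₁ : ∑ c, w c = 1) (hu₁ : ∑ c, u c = 1) (hg : ∀ c, |g c| ≤ G) :
    γ * ∑ c, g c * (w c - u c) ≤ ∑ c, u c * Real.log (mdUpdate γ g w c)
      - ∑ c, u c * Real.log (w c) + γ ^ 2 * G ^ 2 / 2 := by
  set Z := ∑ c', w c' * Real.exp (-γ * g c') with hZ
  have hZpos : 0 < Z := normalizer_pos hw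
  -- The potential is ∑ u log w. One update changes it by -γ⟨g, u⟩ - log Z, and Hoeffding's lemma
  -- bounds log Z by -γ⟨g, w⟩ + γ²G²/2.
  have hlog : ∀ c, Real.log (mdUpdate γ g w c) = Real.log (w c) + -γ * g c - Real.log Z := by
    intro c
    rw [mdUpdate_eq hw, Real.log_div (mul_pos (hw c) (Real.exp_pos _)).ne' hZpos.ne',
      Real.log_mul (hw c).ne' (Real.exp_pos _).ne', Real.log_exp]
  have hZle : Real.log Z ≤ -γ * (∑ c, g c * w c) + γ ^ 2 * G ^ 2 / 2 := by
    rw [Real.log_le_iff_le_exp hZpos]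
    exact sum_mul_exp_neg_le (fun c => (hw c).le) hw₁ hg γ
  have hsum : ∑ c, u c * Real.log (mdUpdate γ g w c)
      = ∑ c, u c * Real.log (w c) - γ * ∑ c, g c * u c - Real.log Z := by
    have : ∀ c, u c * Real.log (mdUpdate γ g w c)
        = u c * Real.log (w c) - γ * (g c * u c) - u c * Real.log Z := fun c => by
      rw [hlog c]
      ring
    simp only [this, Finset.sum_sub_distrib, ← Finset.mul_sum, ← Finset.sum_mul, hu₁, one_mul]
  have hdiff : ∑ c, g c * (w c - u c) = ∑ c, g c * w c - ∑ c, g c * u c := by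
    simp only [mul_sub, Finset.sum_sub_distrib]
  rw [hsum, hdiff]
  linarith

/-- The regret bound for exponentiated gradient. -/
theorem exponentiatedGradient_regret {γ G : ℝ} {g w : ℕ → LiftedCoord n → ℝ}
    {u : LiftedCoord n → ℝ} (h0 : ∀ c, w 0 c = 1 / (2 * n + 1))
    (hw : ∀ t, (∀ c, 0 < w t c) ∧ ∑ c, w t c = 1)
    (hstep : ∀ t, w (t + 1) = mdUpdate γ (g t) (w t)) (hu : ∀ c, 0 ≤ u c)
    (hu₁ : ∑ c, u c = 1) (hg : ∀ t c, |g t c| ≤ G) (T : ℕ) :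
    γ * ∑ t ∈ Finset.range T, ∑ c, g t c * (w t c - u c)
      ≤ Real.log (2 * n + 1) + T * (γ ^ 2 * G ^ 2 / 2) := by
  have htel : γ * ∑ t ∈ Finset.range T, ∑ c, g t c * (w t c - u c)
      ≤ ∑ c, u c * Real.log (w T c) - ∑ c, u c * Real.log (w 0 c)
        + T * (γ ^ 2 * G ^ 2 / 2) := by
    induction T with
    | zero => simp
    | succ T ih =>
      have := mdUpdate_potential (γ := γ) (hw T).1 (hw T).2 hu₁ (hg T)
      rw [← hstep] at this
      rw [Finset.sum_range_succ, mul_add]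
      push_cast
      linarith
  -- The telescoped potential starts at -log(2n+1), by uniformity of the first iterate, and never
  -- exceeds 0.
  have hT : ∑ c, u c * Real.log (w T c) ≤ 0 := by
    refine Finset.sum_nonpos fun c _ => mul_nonpos_of_nonneg_of_nonpos (hu c) ?_
    refine Real.log_nonpos ((hw T).1 c).le ?_
    rw [← (hw T).2]
    exact Finset.single_le_sum (fun c _ => ((hw T).1 c).le) (Finset.mem_univ c)
  have h0' : ∑ c, u c * Real.log (w 0 c) = -Real.log (2 * n + 1) := by
    simp only [h0, one_div, Real.log_inv, ← Finset.sum_mul, hu₁, one_mul]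
  linarith

theorem mdIterate_prob {N : ℕ} (W : ℝ) (T : ℕ) (x : Fin N → Fin n → ℝ) (y : Fin N → ℝ)
    (t : ℕ) : (∀ c, 0 < mdIterate W T x y t c) ∧ ∑ c, mdIterate W T x y t c = 1 := by
  have hd : (0 : ℝ) < 2 * n + 1 := by positivity
  induction t with
  | zero =>
    refine ⟨fun c => by rw [mdIterate]; positivity, ?_⟩
    simp only [mdIterate, Finset.sum_const, Finset.card_univ, nsmul_eq_mul, card_liftedCoord]
    exact mul_one_div_cancel hd.ne'
  | succ t ih => exact ⟨mdUpdate_pos ih.1, sum_mdUpdate ih.1⟩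

/-- The logistic function is strongly monotone on bounded intervals. -/
theorem sigmoid_strongly_monotone {L a b : ℝ} (ha : |a| ≤ L) (hb : |b| ≤ L) :
    Real.exp (-L) / 4 * (b - a) ^ 2 ≤ (Real.sigmoid b - Real.sigmoid a) * (b - a) := by
  have hderiv : ∀ x, |x| ≤ L → Real.exp (-L) / 4 ≤ deriv Real.sigmoid x := by
    intro x hx
    obtain ⟨h₁, h₂⟩ := abs_le.1 hx
    simp only [Real.deriv_sigmoid]
    -- σ'(x) = σ(x)σ(-x) = 1/(2 + e^x + e^{-x}), and for |x| ≤ L the denominator is at most 2 + 2e^L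
    -- ≤ 4e^L.
    rw [← Real.sigmoid_neg, Real.sigmoid_def, Real.sigmoid_def, neg_neg,
      ← mul_inv, Real.exp_neg, ← one_div, ← one_div, div_div]
    refine one_div_le_one_div_of_le (by positivity) ?_
    have e₁ : Real.exp x ≤ Real.exp L := Real.exp_le_exp.2 h₂
    have e₂ : Real.exp (-x) ≤ Real.exp L := Real.exp_le_exp.2 (by linarith)
    have e₃ : 1 ≤ Real.exp L := Real.one_le_exp ((abs_nonneg x).trans hx)
    have e₄ : Real.exp (-x) * Real.exp x = 1 := by rw [← Real.exp_add]; simp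
    nlinarith
  have key : ∀ a b : ℝ, |a| ≤ L → |b| ≤ L → a ≤ b →
      Real.exp (-L) / 4 * (b - a) ≤ Real.sigmoid b - Real.sigmoid a := by
    intro a b ha hb hab
    refine Convex.mul_sub_le_image_sub_of_le_deriv (convex_Icc (-L) L)
      continuous_sigmoid.continuousOn differentiable_sigmoid.differentiableOn
      (fun x hx => hderiv x (abs_le.2 (Set.mem_Icc.1 (interior_subset hx)))) a (abs_le.1 ha) b (abs_le.1 hb) hab
  rcases le_total a b with hab | hab
  · nlinarith [key a b ha hb hab]
  · nlinarith [key b a hb ha hab]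

/-- The vector represented by a point of the simplex. -/
def simplexVector (W : ℝ) (w : LiftedCoord n → ℝ) (j : Fin n) : ℝ :=
  (w (.inl (.inl j)) - w (.inl (.inr j))) * W

theorem sum_mul_liftSample (W : ℝ) (w : LiftedCoord n → ℝ) (x : Fin n → ℝ) :
    ∑ c, w c * liftSample W x c = ∑ j, simplexVector W w j * x j := by
  simp only [Fintype.sum_sum_type, liftSample, Sum.elim_inl, Sum.elim_inr, mul_zero,
    Finset.sum_const_zero, add_zero, ← Finset.sum_add_distrib, simplexVector]
  exact Finset.sum_congr rfl fun j _ => by ring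

theorem sum_abs_simplexVector_le {W : ℝ} (hW : 0 ≤ W) {w : LiftedCoord n → ℝ}
    (hw : ∀ c, 0 ≤ w c) (hw₁ : ∑ c, w c = 1) : ∑ j, |simplexVector W w j| ≤ W := by
  have hle : ∀ j, |simplexVector W w j| ≤ (w (.inl (.inl j)) + w (.inl (.inr j))) * W := by
    intro j
    rw [simplexVector, abs_mul, abs_of_nonneg hW]
    refine mul_le_mul_of_nonneg_right ?_ hW
    exact (abs_sub _ _).trans_eq (by rw [abs_of_nonneg (hw _), abs_of_nonneg (hw _)])
  refine (Finset.sum_le_sum fun j _ => hle j).trans ?_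
  rw [← Finset.sum_mul, Finset.sum_add_distrib]
  rw [Fintype.sum_sum_type, Fintype.sum_sum_type] at hw₁
  simp only [Finset.univ_unique, Finset.sum_singleton] at hw₁
  have h1 : (∑ j, w (.inl (.inl j)) + ∑ j, w (.inl (.inr j))) ≤ 1 := by
    have : 0 ≤ w (.inr default) := hw _
    linarith
  calc _ ≤ 1 * W := mul_le_mul_of_nonneg_right h1 hW
    _ = W := one_mul W

/-- Every vector in the `ℓ₁` ball is represented by a point of the simplex. -/
theorem exists_simplexVector_eq {W : ℝ} (hW : 0 < W) {v : Fin n → ℝ} (hv : ∑ j, |v j| ≤ W) :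
    ∃ u : LiftedCoord n → ℝ, (∀ c, 0 ≤ u c) ∧ ∑ c, u c = 1 ∧ simplexVector W u = v := by
  -- Positive and negative parts of v, scaled by 1/W; the null coordinate of the lift absorbs the
  -- unused mass.
  refine ⟨Sum.elim (Sum.elim (fun j => max (v j) 0 / W) (fun j => max (-v j) 0 / W))
    (fun _ => 1 - (∑ j, |v j|) / W), ?_, ?_, ?_⟩
  · rintro ((j | j) | j)
    · exact div_nonneg (le_max_right _ _) hW.le
    · exact div_nonneg (le_max_right _ _) hW.le
    · simpa using (div_le_one hW).2 hv
  · simp only [Fintype.sum_sum_type, Sum.elim_inl, Sum.elim_inr, Finset.univ_unique,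
      Finset.sum_singleton, ← Finset.sum_div]
    rw [← add_div, ← Finset.sum_add_distrib]
    have : ∀ j, max (v j) 0 + max (-v j) 0 = |v j| := fun j => by
      rcases le_total 0 (v j) with h | h
      · rw [max_eq_left h, max_eq_right (by linarith), abs_of_nonneg h, add_zero]
      · rw [max_eq_right h, max_eq_left (by linarith), abs_of_nonpos h, zero_add]
    simp only [this]
    ring
  · funext j
    simp only [simplexVector, Sum.elim_inl, Sum.elim_inr]
    rw [← sub_div, div_mul_cancel₀ _ hW.ne']
    rcases le_total 0 (v j) with h | h
    · rw [max_eq_left h, max_eq_right (by linarith), sub_zero]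
    · rw [max_eq_right h, max_eq_left (by linarith)]
      ring

end

/-! ### From small regret to small parameter error. -/

section

variable {n N T : ℕ} {W h κ : ℝ} {x : Fin N → Fin n → ℝ} {y : Fin N → ℝ} {v : Fin n → ℝ}

theorem abs_mdGradient_le (hW : 0 ≤ W) (hx : ∀ m j, |x m j| ≤ 1) (hy : ∀ m, |y m| ≤ 1)
    (w : LiftedCoord n → ℝ) (c : LiftedCoord n) : |mdGradient W x y w c| ≤ W := by
  have hterm : ∀ m, |(Real.sigmoid (∑ c', w c' * liftSample W (x m) c') - (y m + 1) / 2)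
      * liftSample W (x m) c| ≤ W := by
    intro m
    have h₁ : |Real.sigmoid (∑ c', w c' * liftSample W (x m) c') - (y m + 1) / 2| ≤ 1 := by
      have h₁ := Real.sigmoid_pos (∑ c', w c' * liftSample W (x m) c')
      have h₂ := Real.sigmoid_lt_one (∑ c', w c' * liftSample W (x m) c')
      obtain ⟨h₃, h₄⟩ := abs_le.1 (hy m)
      rw [abs_le]
      constructor <;> linarith
    have h₂ : |liftSample W (x m) c| ≤ W := by
      rcases c with (j | j) | j
      · simpa [liftSample, abs_mul, abs_of_nonneg hW] using
          mul_le_of_le_one_left hW (hx m j)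
      · simpa [liftSample, abs_mul, abs_of_nonneg hW] using
          mul_le_of_le_one_left hW (hx m j)
      · simpa [liftSample] using hW
    rw [abs_mul]
    exact (mul_le_mul h₁ h₂ (abs_nonneg _) zero_le_one).trans_eq (one_mul W)
  rw [mdGradient, abs_mul, abs_of_nonneg (by positivity)]
  have hsum := (Finset.abs_sum_le_sum_abs _ Finset.univ).trans
    (Finset.sum_le_sum fun m _ => hterm m)
  rw [Finset.sum_const, Finset.card_univ, Fintype.card_fin, nsmul_eq_mul] at hsum
  refine (mul_le_mul_of_nonneg_left hsum (by positivity)).trans ?_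
  rcases Nat.eq_zero_or_pos N with hN | hN
  · simpa [hN] using hW
  · rw [← mul_assoc, one_div_mul_cancel (by positivity), one_mul]

/-- The linearized loss in terms of represented vectors. -/
theorem sum_mdGradient_mul (w u : LiftedCoord n → ℝ) :
    ∑ c, mdGradient W x y w c * (w c - u c) = (1 / (N : ℝ)) * ∑ m,
      (Real.sigmoid (∑ j, simplexVector W w j * x m j) - (y m + 1) / 2)
        * (∑ j, simplexVector W w j * x m j - ∑ j, simplexVector W u j * x m j) := by
  simp only [mdGradient, ← sum_mul_liftSample, ← Finset.sum_sub_distrib, Finset.mul_sum,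
    Finset.sum_mul]
  rw [Finset.sum_comm]
  refine Finset.sum_congr rfl fun m _ => Finset.sum_congr rfl fun c _ => ?_
  ring

theorem abs_sum_mul_le {a b : Fin n → ℝ} {B : ℝ} (hb : ∀ j, |b j| ≤ B) :
    |∑ j, a j * b j| ≤ (∑ j, |a j|) * B := by
  rw [Finset.sum_mul]
  refine (Finset.abs_sum_le_sum_abs _ _).trans (Finset.sum_le_sum fun j _ => ?_)
  rw [abs_mul]
  exact mul_le_mul_of_nonneg_left (hb j) (abs_nonneg _)

/-- The regret of an iterate controls its distance to a vector at which the gradient is small,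
provided the empirical second moments are close to nondegenerate ones. -/
theorem sum_mdGradient_mul_ge (hh : 0 ≤ h)
    (hx : ∀ m j, |x m j| ≤ 1) (hv : ∑ j, |v j| ≤ W)
    (hgrad : ∀ j, |(1 / (N : ℝ)) * ∑ m, (Real.sigmoid (∑ k, v k * x m k) - (y m + 1) / 2)
      * x m j| ≤ h)
    {S : Fin n → Fin n → ℝ} (hS : ∀ j k, |(1 / (N : ℝ)) * ∑ m, x m j * x m k - S j k| ≤ h)
    {j₀ : Fin n} (hκ : ∀ a : Fin n → ℝ, κ * a j₀ ^ 2 ≤ ∑ j, a j * ∑ k, a k * S j k)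
    {w u : LiftedCoord n → ℝ} (hu : simplexVector W u = v)
    (hw : ∑ j, |simplexVector W w j| ≤ W) :
    Real.exp (-W) / 4 * κ * (simplexVector W w j₀ - v j₀) ^ 2
      ≤ ∑ c, mdGradient W x y w c * (w c - u c) + 2 * W * h + Real.exp (-W) * W ^ 2 * h := by
  set b : Fin n → ℝ := simplexVector W w with hb
  set d : Fin n → ℝ := fun j => b j - v j with hd
  have hdle : ∑ j, |d j| ≤ 2 * W := by
    have : ∑ j, |d j| ≤ ∑ j, |b j| + ∑ j, |v j| := by
      rw [← Finset.sum_add_distrib]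
      exact Finset.sum_le_sum fun j _ => abs_sub _ _
    linarith
  have hdx : ∀ m, ∑ j, b j * x m j - ∑ j, v j * x m j = ∑ j, d j * x m j := by
    intro m
    simp only [hd, sub_mul, Finset.sum_sub_distrib]
  have hbound : ∀ a : Fin n → ℝ, ∑ j, |a j| ≤ W → ∀ m, |∑ j, a j * x m j| ≤ W := by
    intro a ha m
    exact (abs_sum_mul_le (hx m)).trans (by rwa [mul_one])
  -- Replacing σ at the iterate by σ at v splits off the gradient at v, which is small, and gains a
  -- quadratic term from strong monotonicity.
  have hmono : ∀ m, (Real.sigmoid (∑ j, v j * x m j) - (y m + 1) / 2) * (∑ j, d j * x m j)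
      + Real.exp (-W) / 4 * (∑ j, d j * x m j) ^ 2
      ≤ (Real.sigmoid (∑ j, b j * x m j) - (y m + 1) / 2) * (∑ j, d j * x m j) := by
    intro m
    have := sigmoid_strongly_monotone (hbound v hv m) (hbound b hw m)
    rw [hdx m] at this
    linarith
  have hlin : -(2 * W * h) ≤ (1 / (N : ℝ)) * ∑ m,
      (Real.sigmoid (∑ j, v j * x m j) - (y m + 1) / 2) * (∑ j, d j * x m j) := by
    have heq : (1 / (N : ℝ)) * ∑ m, (Real.sigmoid (∑ j, v j * x m j) - (y m + 1) / 2)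
        * (∑ j, d j * x m j) = ∑ j, d j * ((1 / (N : ℝ)) * ∑ m,
        (Real.sigmoid (∑ k, v k * x m k) - (y m + 1) / 2) * x m j) := by
      simp only [Finset.mul_sum]
      rw [Finset.sum_comm]
      exact Finset.sum_congr rfl fun j _ => Finset.sum_congr rfl fun m _ => by ring
    rw [heq]
    refine (abs_le.1 ((abs_sum_mul_le hgrad).trans ?_)).1
    exact mul_le_mul_of_nonneg_right hdle hh
  -- Passing from empirical moments to S costs at most ‖d‖₁² h ≤ (2W)² h.
  have hquad : κ * d j₀ ^ 2 - 4 * W ^ 2 * h ≤ (1 / (N : ℝ)) * ∑ m, (∑ j, d j * x m j) ^ 2 := by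
    have heq : (1 / (N : ℝ)) * ∑ m, (∑ j, d j * x m j) ^ 2 - ∑ j, d j * ∑ k, d k * S j k
        = ∑ j, d j * ∑ k, d k * ((1 / (N : ℝ)) * ∑ m, x m j * x m k - S j k) := by
      have hsq : (1 / (N : ℝ)) * ∑ m, (∑ j, d j * x m j) ^ 2
          = ∑ j, d j * ∑ k, d k * ((1 / (N : ℝ)) * ∑ m, x m j * x m k) := by
        simp only [sq, Finset.mul_sum]
        rw [Finset.sum_comm]
        refine Finset.sum_congr rfl fun j _ => ?_
        rw [Finset.sum_comm]
        refine Finset.sum_congr rfl fun m _ => ?_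
        simp only [Finset.sum_mul, Finset.mul_sum]
        exact Finset.sum_congr rfl fun k _ => by ring
      rw [hsq]
      simp only [mul_sub, Finset.sum_sub_distrib]
    have hle : |∑ j, d j * ∑ k, d k * ((1 / (N : ℝ)) * ∑ m, x m j * x m k - S j k)|
        ≤ (∑ j, |d j|) * ((∑ k, |d k|) * h) :=
      abs_sum_mul_le fun j => abs_sum_mul_le (hS j)
    have hle₂ : (∑ j, |d j|) * ((∑ k, |d k|) * h) ≤ 4 * W ^ 2 * h := by
      have h0 : 0 ≤ ∑ j, |d j| := Finset.sum_nonneg fun _ _ => abs_nonneg _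
      rw [← mul_assoc]
      refine mul_le_mul_of_nonneg_right ?_ hh
      nlinarith
    have h₁ := (abs_le.1 (hle.trans hle₂)).1
    have h₂ := hκ d
    linarith
  have hN : (0 : ℝ) ≤ 1 / (N : ℝ) := by positivity
  have hsum := mul_le_mul_of_nonneg_left
    (Finset.sum_le_sum fun m (_ : m ∈ Finset.univ) => hmono m) hN
  rw [Finset.sum_add_distrib, mul_add, ← Finset.mul_sum] at hsum
  rw [sum_mdGradient_mul, ← hb, hu]
  simp only [hdx]
  have he : 0 < Real.exp (-W) / 4 := by positivity
  have := mul_le_mul_of_nonneg_left hquad he.le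
  have hcomm : 1 / (N : ℝ) * (Real.exp (-W) / 4 * ∑ m, (∑ j, d j * x m j) ^ 2)
      = Real.exp (-W) / 4 * (1 / (N : ℝ) * ∑ m, (∑ j, d j * x m j) ^ 2) := by ring
  change Real.exp (-W) / 4 * κ * d j₀ ^ 2 ≤ _
  linarith

/-- Write r = √(2 ln(2n+1)/T), so ln(2n+1) = T r²/2. The step r/(2W) is half the optimal one for
gradients bounded by W; dividing the regret bound by it gives TWr + TWr/4, whence the factor 5/4. -/
theorem mdStepSize_regret (hW : 0 < W) (hn : 0 < n) (hT : 0 < T) {R : ℝ}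
    (hR : mdStepSize n W T * R ≤ Real.log (2 * n + 1)
      + T * (mdStepSize n W T ^ 2 * W ^ 2 / 2)) :
    R ≤ T * (5 / 4 * W * √(2 * Real.log (2 * n + 1) / T)) := by
  have hT' : (0 : ℝ) < T := by exact_mod_cast hT
  have hn' : (0 : ℝ) < n := by exact_mod_cast hn
  have hlog : 0 < Real.log (2 * n + 1) := Real.log_pos (by linarith)
  rw [mdStepSize] at hR
  set r := √(2 * Real.log (2 * n + 1) / T) with hr
  have hrpos : 0 < r := Real.sqrt_pos.2 (by positivity)
  have hr2 : Real.log (2 * n + 1) = T * r ^ 2 / 2 := by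
    rw [hr, Real.sq_sqrt (by positivity)]
    field_simp
  rw [hr2] at hR
  have h₁ : 1 / (2 * W) * r * R ≤ 1 / (2 * W) * r * (T * (5 / 4 * W * r)) := by
    refine hR.trans_eq ?_
    field_simp
    ring
  exact le_of_mul_le_mul_left h₁ (by positivity)

/-- The error of mirror descent when the gradient at `v` is small and the empirical second
moments are close to nondegenerate ones. -/
theorem mirrorDescent_error (hW : 0 < W) (hn : 0 < n) (hT : 0 < T) (hh : 0 ≤ h) (hκ₀ : 0 ≤ κ)
    (hx : ∀ m j, |x m j| ≤ 1) (hy : ∀ m, |y m| ≤ 1) (hv : ∑ j, |v j| ≤ W)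
    (hgrad : ∀ j, |(1 / (N : ℝ)) * ∑ m, (Real.sigmoid (∑ k, v k * x m k) - (y m + 1) / 2)
      * x m j| ≤ h)
    {S : Fin n → Fin n → ℝ} (hS : ∀ j k, |(1 / (N : ℝ)) * ∑ m, x m j * x m k - S j k| ≤ h)
    {j₀ : Fin n} (hκ : ∀ a : Fin n → ℝ, κ * a j₀ ^ 2 ≤ ∑ j, a j * ∑ k, a k * S j k) :
    Real.exp (-W) / 4 * κ * (mirrorDescent W T x y j₀ - v j₀) ^ 2
      ≤ 5 / 4 * W * √(2 * Real.log (2 * n + 1) / T) + 2 * W * h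
        + Real.exp (-W) * W ^ 2 * h := by
  obtain ⟨u, hu, hu₁, huv⟩ := exists_simplexVector_eq hW hv
  have hT' : (0 : ℝ) < T := by exact_mod_cast hT
  set w := mdIterate W T x y with hw
  have hprob := mdIterate_prob W T x y
  have hreg := mdStepSize_regret hW hn hT (exponentiatedGradient_regret
    (g := fun t => mdGradient W x y (w t)) (fun _ => rfl) hprob (fun _ => rfl) hu hu₁
    (fun t c => abs_mdGradient_le hW.le hx hy _ c) T)
  have hstep := fun t => sum_mdGradient_mul_ge (w := w t) hh hx hv hgrad hS hκ huv
    (sum_abs_simplexVector_le hW.le (fun c => ((hprob t).1 c).le) (hprob t).2)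
  have hsum := Finset.sum_le_sum fun t (_ : t ∈ Finset.range T) => hstep t
  simp only [Finset.sum_add_distrib, Finset.sum_const, Finset.card_range, nsmul_eq_mul,
    ← Finset.mul_sum] at hsum
  have havg : mirrorDescent W T x y j₀ - v j₀
      = (∑ t ∈ Finset.range T, (simplexVector W (w t) j₀ - v j₀)) / T := by
    simp only [mirrorDescent, mdAverage, simplexVector, Finset.sum_sub_distrib,
      Finset.sum_const, Finset.card_range, nsmul_eq_mul, ← Finset.sum_mul,
      ← hw]
    field_simp
  -- The output error is the mean of the iterates' errors, so its square is at most the mean of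
  -- their squares.
  have hjensen : T * (mirrorDescent W T x y j₀ - v j₀) ^ 2
      ≤ ∑ t ∈ Finset.range T, (simplexVector W (w t) j₀ - v j₀) ^ 2 := by
    have := sq_sum_le_card_mul_sum_sq (s := Finset.range T)
      (f := fun t => simplexVector W (w t) j₀ - v j₀)
    rw [Finset.card_range] at this
    rw [havg, div_pow]
    calc _ = (∑ t ∈ Finset.range T, (simplexVector W (w t) j₀ - v j₀)) ^ 2 / T := by
          field_simp
      _ ≤ _ := by
          rw [div_le_iff₀ hT', mul_comm]
          exact this
  have hc : 0 ≤ Real.exp (-W) / 4 * κ := by positivity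
  have := mul_le_mul_of_nonneg_left hjensen hc
  refine le_of_mul_le_mul_left ?_ hT'
  linarith

end

/-! ### Concentration of empirical means. -/

open ProbabilityTheory in
/-- Hoeffding's inequality for the empirical mean of a function of i.i.d. samples. -/
theorem pi_pmf_hoeffding {Ω : Type*} [Fintype Ω] [MeasurableSpace Ω]
    [DiscreteMeasurableSpace Ω] (p : PMF Ω) {F : Ω → ℝ} (hF : ∀ ω, |F ω| ≤ 1) {N : ℕ}
    (hN : 0 < N) {h : ℝ} (hh : 0 ≤ h) :
    (Measure.pi fun _ : Fin N => p.toMeasure).real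
      {z | h ≤ (1 / (N : ℝ)) * ∑ m, F (z m) - ∑ ω, (p ω).toReal * F ω}
      ≤ Real.exp (-(N * h ^ 2 / 2)) := by
  set μ := Measure.pi fun _ : Fin N => p.toMeasure
  set E := ∑ ω, (p ω).toReal * F ω with hE
  have hN' : (0 : ℝ) < N := by exact_mod_cast hN
  have hmeas : Measurable F := Measurable.of_discrete
  have hint : ∀ m, ∫ z, F (z m) ∂μ = E := by
    intro m
    rw [integral_comp_eval (μ := fun _ : Fin N => p.toMeasure) (i := m) (f := F)
      hmeas.aestronglyMeasurable, PMF.integral_eq_sum]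
    rfl
  -- Values in [-1, 1] give the sub-Gaussian constant ((1 - (-1))/2)² = 1.
  have hsub : ∀ m ∈ (Finset.univ : Finset (Fin N)),
      HasSubgaussianMGF (fun z => F (z m) - E) 1 μ := by
    intro m _
    have := hasSubgaussianMGF_of_mem_Icc (μ := μ) (X := fun z => F (z m)) (a := -1) (b := 1)
      (hmeas.comp (measurable_pi_apply m)).aemeasurable
      (Filter.Eventually.of_forall fun z => abs_le.1 (hF (z m)))
    rw [hint m] at this
    convert this
    ext
    norm_num
  have hind : iIndepFun (fun m (z : Fin N → Ω) => F (z m) - E) μ :=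
    iIndepFun_pi (μ := fun _ : Fin N => p.toMeasure) (X := fun _ ω => F ω - E)
      fun _ => Measurable.of_discrete.aemeasurable
  have hle := HasSubgaussianMGF.measure_sum_ge_le_of_iIndepFun hind hsub
    (ε := N * h) (by positivity)
  have hset : {z : Fin N → Ω | h ≤ (1 / (N : ℝ)) * ∑ m, F (z m) - E}
      = {z | N * h ≤ ∑ m, (F (z m) - E)} := by
    ext z
    simp only [Set.mem_ofPred_eq, Finset.sum_sub_distrib, Finset.sum_const, Finset.card_univ,
      Fintype.card_fin, nsmul_eq_mul]
    rw [← mul_le_mul_iff_right₀ hN']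
    have : N * (1 / (N : ℝ) * ∑ m, F (z m) - E) = ∑ m, F (z m) - N * E := by
      field_simp
    rw [this]
  rw [hset]
  refine hle.trans_eq ?_
  congr 1
  simp only [Finset.sum_const, Finset.card_univ, Fintype.card_fin, nsmul_eq_mul, mul_one,
    NNReal.coe_natCast]
  field_simp

/-- With high probability, the empirical means of finitely many bounded functions of i.i.d.
samples are all close to their expectations. -/
theorem pi_pmf_uniform_hoeffding {Ω ι : Type*} [Fintype Ω] [MeasurableSpace Ω]
    [DiscreteMeasurableSpace Ω] [Fintype ι] (p : PMF Ω) {F : ι → Ω → ℝ}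
    (hF : ∀ a ω, |F a ω| ≤ 1) {N : ℕ} (hN : 0 < N) {h ρ : ℝ} (hh : 0 ≤ h)
    (hρ : Fintype.card ι * (2 * Real.exp (-(N * h ^ 2 / 2))) ≤ ρ) :
    ENNReal.ofReal (1 - ρ) ≤ (Measure.pi fun _ : Fin N => p.toMeasure)
      {z | ∀ a, |(1 / (N : ℝ)) * ∑ m, F a (z m) - ∑ ω, (p ω).toReal * F a ω| ≤ h} := by
  set μ := Measure.pi fun _ : Fin N => p.toMeasure
  set G := {z : Fin N → Ω |
    ∀ a, |(1 / (N : ℝ)) * ∑ m, F a (z m) - ∑ ω, (p ω).toReal * F a ω| ≤ h} with hG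
  have hneg : ∀ a, μ.real {z : Fin N → Ω |
      h ≤ (1 / (N : ℝ)) * ∑ m, -F a (z m) - ∑ ω, (p ω).toReal * -F a ω}
      ≤ Real.exp (-(N * h ^ 2 / 2)) := fun a =>
    pi_pmf_hoeffding p (F := fun ω => -F a ω) (fun ω => by rw [abs_neg]; exact hF a ω) hN hh
  have hcover : Gᶜ ⊆ ⋃ a, ({z : Fin N → Ω |
      h ≤ (1 / (N : ℝ)) * ∑ m, F a (z m) - ∑ ω, (p ω).toReal * F a ω} ∪
      {z | h ≤ (1 / (N : ℝ)) * ∑ m, -F a (z m) - ∑ ω, (p ω).toReal * -F a ω}) := by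
    intro z hz
    simp only [hG, Set.mem_compl_iff, Set.mem_ofPred_eq, not_forall, not_le] at hz
    obtain ⟨a, ha⟩ := hz
    refine Set.mem_iUnion.2 ⟨a, ?_⟩
    simp only [Set.mem_union, Set.mem_ofPred_eq, Finset.sum_neg_distrib, mul_neg]
    rcases lt_abs.1 ha with h' | h'
    · exact Or.inl h'.le
    · exact Or.inr (by linarith)
  have hcompl : μ.real Gᶜ ≤ ρ := by
    refine (measureReal_mono hcover).trans ((measureReal_iUnion_fintype_le _).trans ?_)
    refine (Finset.sum_le_sum fun a _ => (measureReal_union_le _ _).trans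
      (add_le_add (pi_pmf_hoeffding p (hF a) hN hh) (hneg a))).trans ?_
    rw [Finset.sum_const, Finset.card_univ, nsmul_eq_mul, ← two_mul]
    exact hρ
  have hmeas : MeasurableSet G := by
    exact MeasurableSet.of_discrete
  rw [probReal_compl_eq_one_sub hmeas] at hcompl
  rw [← ofReal_measureReal (measure_ne_top μ G)]
  exact ENNReal.ofReal_le_ofReal (by linarith)

/-! ### The Ising measure under spin flips. -/

theorem spin_eq_or (s : ℤˣ) : spin s = 1 ∨ spin s = -1 := by
  rcases Int.units_eq_one_or s with rfl | rfl <;> simp [spin]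

theorem abs_spin (s : ℤˣ) : |spin s| = 1 := by
  rcases spin_eq_or s with h | h <;> simp [h]

theorem spin_neg (s : ℤˣ) : spin (-s) = -spin s := by
  simp [spin]

section

variable {n : ℕ}

/-- The configuration with one spin flipped. -/
def flipSpin (i : Fin n) (z : Fin n → ℤˣ) : Fin n → ℤˣ :=
  Function.update z i (-z i)

theorem flipSpin_self (i : Fin n) (z : Fin n → ℤˣ) : flipSpin i z i = -z i := by
  simp [flipSpin]

theorem flipSpin_of_ne {i j : Fin n} (hj : j ≠ i) (z : Fin n → ℤˣ) :
    flipSpin i z j = z j := by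
  simp [flipSpin, hj]

theorem flipSpin_involutive (i : Fin n) : Function.Involutive (flipSpin i) := by
  intro z
  simp [flipSpin]

theorem sum_comp_flipSpin (i : Fin n) (f : (Fin n → ℤˣ) → ℝ) :
    ∑ z, f (flipSpin i z) = ∑ z, f z :=
  Equiv.sum_comp (flipSpin_involutive i).toPerm f

theorem spin_flipSpin (i j : Fin n) (z : Fin n → ℤˣ) :
    spin (flipSpin i z j) = spin (z j) + if j = i then -2 * spin (z i) else 0 := by
  by_cases hj : j = i
  · subst hj
    rw [flipSpin_self, spin_neg, if_pos rfl]
    ring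
  · rw [flipSpin_of_ne hj, if_neg hj, add_zero]

variable {A : Matrix (Fin n) (Fin n) ℝ} {θ : Fin n → ℝ}

/-- The local field at a node. -/
noncomputable def localField (A : Matrix (Fin n) (Fin n) ℝ) (θ : Fin n → ℝ) (i : Fin n)
    (z : Fin n → ℤˣ) : ℝ :=
  ∑ j, A i j * spin (z j) + θ i

/-- With zero diagonal the field at i does not see z_i. -/
theorem localField_flipSpin (hdiag : ∀ i, A i i = 0) (i : Fin n) (z : Fin n → ℤˣ) :
    localField A θ i (flipSpin i z) = localField A θ i z := by
  rw [localField, localField]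
  congr 1
  refine Finset.sum_congr rfl fun j _ => ?_
  by_cases hj : j = i
  · simp [hj, hdiag]
  · rw [flipSpin_of_ne hj]

theorem abs_localField_le (i : Fin n) (z : Fin n → ℤˣ) :
    |localField A θ i z| ≤ isingWidth A θ := by
  refine le_trans ?_ (le_ciSup (f := fun i => (∑ j, |A i j|) + |θ i|)
    (Set.finite_range _).bddAbove i)
  refine (abs_add_le _ _).trans (add_le_add_left ?_ _)
  refine (Finset.abs_sum_le_sum_abs _ _).trans (Finset.sum_le_sum fun j _ => ?_)
  rw [abs_mul, abs_spin, mul_one]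

theorem two_mul_sum_Ioi {f : Fin n → Fin n → ℝ} (hsymm : ∀ i j, f i j = f j i)
    (hdiag : ∀ i, f i i = 0) :
    2 * ∑ i, ∑ j ∈ Finset.Ioi i, f i j = ∑ i, ∑ j, f i j := by
  have h := Finset.sum_sum_Ioi_add_eq_sum_sum_off_diag f
  have h₁ : ∀ i, ∑ j ∈ ({i}ᶜ : Finset (Fin n)), f j i = ∑ j, f i j := by
    intro i
    rw [← Finset.sum_compl_add_sum {i}, Finset.sum_singleton, hdiag, add_zero]
    exact Finset.sum_congr rfl fun j _ => hsymm j i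
  simp only [h₁] at h
  rw [← h, Finset.mul_sum]
  refine Finset.sum_congr rfl fun i _ => ?_
  rw [Finset.mul_sum]
  exact Finset.sum_congr rfl fun j _ => by rw [hsymm j i, two_mul]

/-- The sum over i < j is half the full double sum, in which the flip adds δ = -2 z_i to one spin.
The two cross terms agree by symmetry, and the δ² term carries A i i = 0. -/
theorem isingWeight_flipSpin (hA : A.IsSymm) (hdiag : ∀ i, A i i = 0) (i : Fin n)
    (z : Fin n → ℤˣ) : isingWeight A θ (flipSpin i z)
      = isingWeight A θ z * Real.exp (-2 * spin (z i) * localField A θ i z) := by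
  rw [isingWeight, isingWeight, ← Real.exp_add]
  congr 1
  have hhalf : ∀ z : Fin n → ℤˣ, ∑ i, ∑ j ∈ Finset.Ioi i, A i j * spin (z i) * spin (z j)
      = (∑ i, ∑ j, A i j * spin (z i) * spin (z j)) / 2 := by
    intro z
    rw [← two_mul_sum_Ioi (f := fun i j => A i j * spin (z i) * spin (z j))
      (fun i j => by rw [hA.apply i j]; ring) (fun i => by rw [hdiag]; ring)]
    ring
  have hcol : ∀ j, A j i = A i j := fun j => hA.apply i j
  set δ := -2 * spin (z i) with hδ
  have hquad : ∑ k, ∑ j, A k j * spin (flipSpin i z k) * spin (flipSpin i z j)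
      = ∑ k, ∑ j, A k j * spin (z k) * spin (z j) + 2 * δ * ∑ j, A i j * spin (z j) := by
    have : ∀ k j, A k j * spin (flipSpin i z k) * spin (flipSpin i z j)
        = A k j * spin (z k) * spin (z j) + (if j = i then A k j * spin (z k) * δ else 0)
        + (if k = i then A k j * δ * spin (z j) else 0)
        + (if j = i then (if k = i then A k j * δ * δ else 0) else 0) := by
      intro k j
      rw [spin_flipSpin, spin_flipSpin, ← hδ]
      split_ifs <;> ring
    simp only [this, Finset.sum_add_distrib, Finset.sum_ite_eq', Finset.mem_univ, if_true, hdiag]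
    rw [Finset.sum_comm (f := fun k j => if k = i then A k j * δ * spin (z j) else 0)]
    simp only [Finset.sum_ite_eq', Finset.mem_univ, if_true, hcol, Finset.mul_sum,
      zero_mul, add_zero]
    rw [add_assoc, ← Finset.sum_add_distrib]
    congr 1
    exact Finset.sum_congr rfl fun j _ => by ring
  have hlin : ∑ k, θ k * spin (flipSpin i z k) = ∑ k, θ k * spin (z k) + δ * θ i := by
    simp only [spin_flipSpin, ← hδ, mul_add, Finset.sum_add_distrib, mul_ite, mul_zero,
      Finset.sum_ite_eq', Finset.mem_univ, if_true]
    ring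
  rw [hhalf, hhalf, hquad, hlin, localField]
  ring

/-- The probability of a configuration. -/
theorem isingPMF_toReal (z : Fin n → ℤˣ) :
    (isingPMF A θ z).toReal = isingWeight A θ z / ∑ z', isingWeight A θ z' :=
  ENNReal.toReal_ofReal (div_nonneg (Real.exp_pos _).le
    (Finset.sum_nonneg fun _ _ => (Real.exp_pos _).le))

/-- The partition function cancels. Apart from total mass one, this is all that the two expectation
lemmas below need to know about the Ising law. -/
theorem isingPMF_flipSpin (hA : A.IsSymm) (hdiag : ∀ i, A i i = 0) (i : Fin n)
    (z : Fin n → ℤˣ) : (isingPMF A θ (flipSpin i z)).toReal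
      = (isingPMF A θ z).toReal * Real.exp (-2 * spin (z i) * localField A θ i z) := by
  rw [isingPMF_toReal, isingPMF_toReal, isingWeight_flipSpin hA hdiag]
  ring

theorem sum_isingPMF : ∑ z, (isingPMF A θ z).toReal = 1 := by
  simp only [isingPMF_toReal, ← Finset.sum_div]
  exact div_self (Finset.sum_pos (fun z _ => Real.exp_pos _) Finset.univ_nonempty).ne'

theorem exp_neg_width_le (i : Fin n) (z : Fin n → ℤˣ) :
    Real.exp (-2 * isingWidth A θ) ≤ Real.exp (-2 * spin (z i) * localField A θ i z) := by
  refine Real.exp_le_exp.2 ?_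
  obtain ⟨h₁, h₂⟩ := abs_le.1 (abs_localField_le (A := A) (θ := θ) i z)
  rcases spin_eq_or (z i) with h | h <;> rw [h] <;> linarith

/-- The regression vector of a node. -/
def nodeWeights (A : Matrix (Fin n) (Fin n) ℝ) (θ : Fin n → ℝ) (i j : Fin n) : ℝ :=
  2 * if j = i then θ i else A i j

theorem sum_nodeWeights_mul (hdiag : ∀ i, A i i = 0) (i : Fin n) (z : Fin n → ℤˣ) :
    ∑ j, nodeWeights A θ i j * nodeFeature i z j = 2 * localField A θ i z := by
  have : ∀ j, nodeWeights A θ i j * nodeFeature i z j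
      = 2 * (A i j * spin (z j)) + if j = i then 2 * θ i else 0 := by
    intro j
    by_cases hj : j = i
    · subst hj
      simp [nodeWeights, nodeFeature, hdiag]
    · simp only [nodeWeights, nodeFeature, if_neg hj]
      ring
  simp only [this, Finset.sum_add_distrib, ← Finset.mul_sum, Finset.sum_ite_eq',
    Finset.mem_univ, if_true, localField]
  ring

theorem sum_abs_nodeWeights_le (hdiag : ∀ i, A i i = 0) (i : Fin n) :
    ∑ j, |nodeWeights A θ i j| ≤ 2 * isingWidth A θ := by
  have : ∀ j, |nodeWeights A θ i j| = 2 * |A i j| + if j = i then 2 * |θ i| else 0 := by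
    intro j
    by_cases hj : j = i
    · subst hj
      simp [nodeWeights, hdiag, abs_mul]
    · simp [nodeWeights, hj, abs_mul]
  simp only [this, Finset.sum_add_distrib, ← Finset.mul_sum, Finset.sum_ite_eq',
    Finset.mem_univ, if_true]
  rw [← mul_add]
  exact mul_le_mul_of_nonneg_left (le_ciSup (f := fun i => (∑ j, |A i j|) + |θ i|)
    (Set.finite_range _).bddAbove i) zero_le_two

theorem abs_nodeFeature_le (i : Fin n) (z : Fin n → ℤˣ) (j : Fin n) :
    |nodeFeature i z j| ≤ 1 := by
  rw [nodeFeature]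
  split_ifs
  · simp
  · rw [abs_spin]

theorem nodeFeature_flipSpin_self (i : Fin n) (z : Fin n → ℤˣ) :
    nodeFeature i (flipSpin i z) = nodeFeature i z := by
  funext j
  rw [nodeFeature, nodeFeature]
  split_ifs with hj
  · rfl
  · rw [flipSpin_of_ne hj]

/-- The expected gradient of the logistic loss vanishes at the true regression vector. -/
theorem expected_gradient_eq_zero (hA : A.IsSymm) (hdiag : ∀ i, A i i = 0) (i j : Fin n) :
    ∑ z, (isingPMF A θ z).toReal *
      ((Real.sigmoid (∑ k, nodeWeights A θ i k * nodeFeature i z k) - (spin (z i) + 1) / 2)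
        * nodeFeature i z j) = 0 := by
  set f : (Fin n → ℤˣ) → ℝ := fun z => (isingPMF A θ z).toReal *
      ((Real.sigmoid (∑ k, nodeWeights A θ i k * nodeFeature i z k) - (spin (z i) + 1) / 2)
        * nodeFeature i z j) with hf
  -- The flip preserves the features and the field H, so the pair cancels by the logistic identity;
  -- for z_i = 1 it reads (σ(2H) - 1) + e^{-2H} σ(2H) = 0.
  have hpair : ∀ z, f z + f (flipSpin i z) = 0 := by
    intro z
    simp only [hf, sum_nodeWeights_mul hdiag, isingPMF_flipSpin hA hdiag,
      localField_flipSpin hdiag, nodeFeature_flipSpin_self, flipSpin_self, spin_neg]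
    set H := localField A θ i z
    have hfactor : ∀ p e a b x : ℝ, a + e * b = 0 → p * (a * x) + p * e * (b * x) = 0 := by
      intro p e a b x hab
      linear_combination p * x * hab
    refine hfactor _ _ _ _ _ ?_
    have hpos : 0 < 1 + Real.exp (-(2 * H)) := by positivity
    have hexp : Real.exp (2 * H) * Real.exp (-(2 * H)) = 1 := by
      rw [← Real.exp_add]
      simp
    rw [Real.sigmoid_def]
    rcases spin_eq_or (z i) with h | h
    · rw [h, show -2 * 1 * H = -(2 * H) by ring]
      field_simp
      ring
    · rw [h, show -2 * -1 * H = 2 * H by ring]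
      field_simp
      linear_combination -2 * hexp
  have h2 : ∑ z, f z + ∑ z, f z = 0 := by
    nth_rw 2 [← sum_comp_flipSpin i f]
    rw [← Finset.sum_add_distrib]
    exact Finset.sum_eq_zero fun z _ => hpair z
  linarith

/-- The second moments of the regression vector of a node. -/
noncomputable def featureMoment (A : Matrix (Fin n) (Fin n) ℝ) (θ : Fin n → ℝ)
    (i j k : Fin n) : ℝ :=
  ∑ z, (isingPMF A θ z).toReal * (nodeFeature i z j * nodeFeature i z k)

theorem nodeFeature_flipSpin {i j₀ : Fin n} (hj₀ : j₀ ≠ i) (z : Fin n → ℤˣ) (j : Fin n) :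
    nodeFeature i (flipSpin j₀ z) j
      = nodeFeature i z j + if j = j₀ then -2 * spin (z j₀) else 0 := by
  by_cases hj : j = i
  · subst hj
    simp [nodeFeature, hj₀.symm]
  · simp only [nodeFeature, if_neg hj, spin_flipSpin]

/-- The conditional variance of every spin is bounded below. -/
theorem featureMoment_lower_bound (hA : A.IsSymm) (hdiag : ∀ i, A i i = 0) {i j₀ : Fin n}
    (hj₀ : j₀ ≠ i) (a : Fin n → ℝ) :
    Real.exp (-2 * isingWidth A θ) * a j₀ ^ 2
      ≤ ∑ j, a j * ∑ k, a k * featureMoment A θ i j k := by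
  set P : (Fin n → ℤˣ) → ℝ := fun z => (isingPMF A θ z).toReal with hP
  set D : (Fin n → ℤˣ) → ℝ := fun z => ∑ j, a j * nodeFeature i z j with hD
  set κ := Real.exp (-2 * isingWidth A θ) with hκ
  -- The form is the expectation of D², with D the linear functional ⟨a, x⟩ of the features.
  have hrhs : ∑ j, a j * ∑ k, a k * featureMoment A θ i j k = ∑ z, P z * D z ^ 2 := by
    have hz : ∀ z, P z * D z ^ 2
        = ∑ j, ∑ k, a j * (a k * (P z * (nodeFeature i z j * nodeFeature i z k))) := by
      intro z
      simp only [hD, sq, Finset.mul_sum]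
      refine Finset.sum_congr rfl fun j _ => ?_
      simp only [Finset.sum_mul, Finset.mul_sum]
      exact Finset.sum_congr rfl fun k _ => by ring
    simp only [hz, featureMoment, Finset.mul_sum]
    rw [Finset.sum_comm (s := (Finset.univ : Finset (Fin n → ℤˣ)))]
    exact Finset.sum_congr rfl fun j _ => Finset.sum_comm
  have hflip : ∀ z, D (flipSpin j₀ z) = D z - 2 * (a j₀ * spin (z j₀)) := by
    intro z
    simp only [hD, nodeFeature_flipSpin hj₀, mul_add, Finset.sum_add_distrib, mul_ite, mul_zero,
      Finset.sum_ite_eq', Finset.mem_univ, if_true]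
    ring
  have hPpos : ∀ z, 0 ≤ P z := fun z => ENNReal.toReal_nonneg
  have hPle : ∀ z, κ * P z ≤ P (flipSpin j₀ z) := by
    intro z
    simp only [hP, isingPMF_flipSpin hA hdiag]
    rw [mul_comm]
    exact mul_le_mul_of_nonneg_left (exp_neg_width_le j₀ z) (hPpos z)
  have hPle' : ∀ z, κ * P (flipSpin j₀ z) ≤ P z := by
    intro z
    have := hPle (flipSpin j₀ z)
    rwa [flipSpin_involutive j₀ z] at this
  have hκ1 : κ ≤ 1 := Real.exp_le_one_iff.2 (by
    have := (abs_nonneg _).trans (abs_localField_le (A := A) (θ := θ) i fun _ => 1)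
    linarith)
  -- The two values of D in a pair differ by 2|a_{j₀}|, so their squares sum to at least 2a_{j₀}².
  -- The smaller of the two probabilities is at least κ times the larger. Summing over all z doubles
  -- both sides.
  have hpair : ∀ z, κ * a j₀ ^ 2 * (P z + P (flipSpin j₀ z))
      ≤ P z * D z ^ 2 + P (flipSpin j₀ z) * D (flipSpin j₀ z) ^ 2 := by
    intro z
    have hD2 : 2 * a j₀ ^ 2 ≤ D z ^ 2 + D (flipSpin j₀ z) ^ 2 := by
      rw [hflip]
      have : spin (z j₀) ^ 2 = 1 := by rw [← sq_abs, abs_spin, one_pow]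
      nlinarith [sq_nonneg (D z - a j₀ * spin (z j₀))]
    set d := D z
    set d' := D (flipSpin j₀ z)
    set p := P z with hp
    set p' := P (flipSpin j₀ z) with hp'
    have hmin : ∀ p p' d d' : ℝ, 0 ≤ p → p ≤ p' → κ * p' ≤ p → 2 * a j₀ ^ 2 ≤ d ^ 2 + d' ^ 2 →
        κ * a j₀ ^ 2 * (p + p') ≤ p * d ^ 2 + p' * d' ^ 2 := by
      intro p p' d d' h0 h1 h2 h3
      have e₁ : κ * a j₀ ^ 2 * (p + p') ≤ 2 * p * a j₀ ^ 2 := by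
        have : κ * p ≤ p := mul_le_of_le_one_left h0 hκ1
        nlinarith [sq_nonneg (a j₀)]
      have e₂ : 2 * p * a j₀ ^ 2 ≤ p * (d ^ 2 + d' ^ 2) := by nlinarith
      have e₃ : p * d' ^ 2 ≤ p' * d' ^ 2 := mul_le_mul_of_nonneg_right h1 (sq_nonneg _)
      linarith
    rcases le_total p p' with hle | hle
    · exact hmin p p' d d' (hPpos z) hle (hPle' z) hD2
    · have := hmin p' p d' d (hPpos _) hle (hPle z) (by linarith)
      linarith
  have hsum := Finset.sum_le_sum fun z (_ : z ∈ Finset.univ) => hpair z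
  rw [← Finset.mul_sum, Finset.sum_add_distrib, Finset.sum_add_distrib, sum_comp_flipSpin j₀ P,
    sum_comp_flipSpin j₀ fun z => P z * D z ^ 2, sum_isingPMF] at hsum
  rw [hrhs]
  linarith

end

/-! ### The statistical guarantee. -/

section

variable {n N T : ℕ} {A : Matrix (Fin n) (Fin n) ℝ} {θ : Fin n → ℝ} {lam ρ ε h : ℝ}

/-- The bounded functions of a sample whose empirical means the analysis controls. -/
noncomputable def sampleStatistic (A : Matrix (Fin n) (Fin n) ℝ) (θ : Fin n → ℝ) :
    (Fin n × Fin n) ⊕ (Fin n × Fin n × Fin n) → (Fin n → ℤˣ) → ℝ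
  | .inl (i, j), z =>
    (Real.sigmoid (∑ k, nodeWeights A θ i k * nodeFeature i z k) - (spin (z i) + 1) / 2)
      * nodeFeature i z j
  | .inr (i, j, k), z => nodeFeature i z j * nodeFeature i z k

theorem abs_sampleStatistic_le (a : (Fin n × Fin n) ⊕ (Fin n × Fin n × Fin n))
    (z : Fin n → ℤˣ) : |sampleStatistic A θ a z| ≤ 1 := by
  rcases a with ⟨i, j⟩ | ⟨i, j, k⟩
  · rw [sampleStatistic, abs_mul]
    refine mul_le_one₀ ?_ (abs_nonneg _) (abs_nodeFeature_le i z j)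
    have h₁ := Real.sigmoid_pos (∑ k, nodeWeights A θ i k * nodeFeature i z k)
    have h₂ := Real.sigmoid_lt_one (∑ k, nodeWeights A θ i k * nodeFeature i z k)
    rw [abs_le]
    rcases spin_eq_or (z i) with h | h <;> rw [h] <;> constructor <;> linarith
  · rw [sampleStatistic, abs_mul]
    exact mul_le_one₀ (abs_nodeFeature_le i z j) (abs_nonneg _) (abs_nodeFeature_le i z k)

/-- The estimation error for samples whose statistics are close to their expectations. -/
theorem isingEstimate_error (hA : A.IsSymm) (hdiag : ∀ i, A i i = 0)
    (hlam : isingWidth A θ ≤ lam) (hlam₀ : 0 < lam) (hT : 0 < T) (hh : 0 ≤ h)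
    {z : Fin N → Fin n → ℤˣ}
    (hz : ∀ a, |(1 / (N : ℝ)) * ∑ m, sampleStatistic A θ a (z m)
      - ∑ ω, (isingPMF A θ ω).toReal * sampleStatistic A θ a ω| ≤ h)
    {i j : Fin n} (hij : j ≠ i) :
    Real.exp (-(4 * lam)) * (A i j - isingEstimate lam T z i j) ^ 2
      ≤ 5 / 2 * lam * √(2 * Real.log (2 * n + 1) / T) + 4 * lam * h
        + 4 * Real.exp (-(2 * lam)) * lam ^ 2 * h := by
  have herr := mirrorDescent_error (W := 2 * lam) (T := T) (h := h)
    (κ := Real.exp (-(2 * lam))) (x := fun m => nodeFeature i (z m))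
    (y := fun m => spin (z m i)) (v := nodeWeights A θ i) (S := featureMoment A θ i) (j₀ := j)
    (by linarith) i.pos hT hh (Real.exp_pos _).le (fun m => abs_nodeFeature_le i (z m))
    (fun m => (abs_spin _).le) ((sum_abs_nodeWeights_le hdiag i).trans (by linarith))
    (fun k => by
      have := hz (.inl (i, k))
      simp only [sampleStatistic, expected_gradient_eq_zero hA hdiag, sub_zero] at this
      exact this)
    (fun k l => hz (.inr (i, k, l)))
    (fun a => by
      refine le_trans ?_ (featureMoment_lower_bound hA hdiag hij a)
      refine mul_le_mul_of_nonneg_right (Real.exp_le_exp.2 ?_) (sq_nonneg _)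
      linarith)
  set M := mirrorDescent (2 * lam) T (fun m => nodeFeature i (z m)) (fun m => spin (z m i)) j
    with hM
  have hw : nodeWeights A θ i j = 2 * A i j := by rw [nodeWeights, if_neg hij]
  have hest : isingEstimate lam T z i j = M / 2 := by rw [isingEstimate, if_neg hij]
  -- One factor is the curvature of σ on [-2λ, 2λ], the other the spin-flip bound; the 1/4 turns (M
  -- - 2A_ij)² into (A_ij - M/2)².
  have hexp : Real.exp (-(4 * lam)) = Real.exp (-(2 * lam)) * Real.exp (-(2 * lam)) := by
    rw [← Real.exp_add]
    congr 1
    ring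
  rw [hw] at herr
  rw [hest, hexp]
  calc _ = Real.exp (-(2 * lam)) / 4 * Real.exp (-(2 * lam)) * (M - 2 * A i j) ^ 2 := by ring
    _ ≤ _ := herr
    _ = _ := by ring

theorem log_two_mul_add_one_le (hn : 2 ≤ n) :
    Real.log (2 * n + 1) ≤ 3 * Real.log n := by
  have hn' : (2 : ℝ) ≤ n := by exact_mod_cast hn
  have hpow : 3 * Real.log n = Real.log ((n : ℝ) ^ 3) := by
    rw [Real.log_pow, Nat.cast_ofNat]
  rw [hpow]
  refine Real.log_le_log (by linarith) ?_
  nlinarith [mul_nonneg (sub_nonneg.2 hn') (sq_nonneg (n : ℝ))]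

theorem card_mul_exp_le (hn : 2 ≤ n) (hρ : 0 < ρ) (hρ₁ : ρ < 1) (hN : 0 < N)
    (hh : h ^ 2 = 10 * Real.log (n / ρ) / N) :
    Fintype.card ((Fin n × Fin n) ⊕ (Fin n × Fin n × Fin n))
      * (2 * Real.exp (-(N * h ^ 2 / 2))) ≤ ρ := by
  have hn' : (2 : ℝ) ≤ n := by exact_mod_cast hn
  have hn0 : (0 : ℝ) < n := by linarith
  have hN' : (0 : ℝ) < N := by exact_mod_cast hN
  -- The 10 in h² is chosen for this fifth power: 2(n² + n³) ≤ n⁵ for n ≥ 2 pays for the union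
  -- bound.
  have hexp : Real.exp (-(N * h ^ 2 / 2)) = (ρ / n) ^ 5 := by
    have : -(N * h ^ 2 / 2) = ((5 : ℕ) : ℝ) * Real.log (ρ / n) := by
      rw [hh, show ρ / n = (n / ρ)⁻¹ from (inv_div _ _).symm, Real.log_inv]
      push_cast
      field_simp
      ring
    rw [this, Real.exp_nat_mul, Real.exp_log (by positivity)]
  have hcard : (Fintype.card ((Fin n × Fin n) ⊕ (Fin n × Fin n × Fin n)) : ℝ)
      = n ^ 2 + n ^ 3 := by
    simp
    ring
  rw [hexp, hcard, div_pow]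
  have hρ5 : ρ ^ 5 ≤ ρ := pow_le_of_le_one hρ.le hρ₁.le (by norm_num)
  have hpoly : ((n : ℝ) ^ 2 + n ^ 3) * 2 ≤ n ^ 5 := by
    have h4 : (4 : ℝ) ≤ n ^ 2 := by nlinarith
    have h3 : (0 : ℝ) < n ^ 3 := by positivity
    have h23 : 2 * (n : ℝ) ^ 2 ≤ n ^ 3 := by nlinarith [sq_nonneg (n : ℝ)]
    nlinarith
  calc ((n : ℝ) ^ 2 + n ^ 3) * (2 * (ρ ^ 5 / n ^ 5))
      = (((n : ℝ) ^ 2 + n ^ 3) * 2 / n ^ 5) * ρ ^ 5 := by ring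
    _ ≤ 1 * ρ := mul_le_mul ((div_le_one (by positivity)).2 hpoly) hρ5 (by positivity)
        zero_le_one
    _ = ρ := one_mul ρ

theorem sqrt_div_le_of_le {X M q c : ℝ} (hX : 0 < X) (hq : 0 < q) (hc : 0 < c) {a : ℝ}
    (hac : a ≤ c ^ 2 * 1000) (hM : 1000 * (X / q ^ 2) ≤ M) :
    √(a * X / M) ≤ c * q := by
  have hM0 : 0 < M := lt_of_lt_of_le (by positivity) hM
  refine Real.sqrt_le_iff.2 ⟨by positivity, ?_⟩
  rw [div_le_iff₀ hM0]
  calc a * X ≤ c ^ 2 * 1000 * X := mul_le_mul_of_nonneg_right hac hX.le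
    _ = (c * q) ^ 2 * (1000 * (X / q ^ 2)) := by
      field_simp
    _ ≤ _ := mul_le_mul_of_nonneg_left hM (by positivity)

/-- The statistical guarantee in the nondegenerate case. -/
theorem isingEstimate_close (hA : A.IsSymm) (hdiag : ∀ i, A i i = 0)
    (hlam : isingWidth A θ ≤ lam) (hlam₀ : 0 < lam) (hn : 2 ≤ n) (hρ : 0 < ρ) (hρ₁ : ρ < 1)
    (hε : 0 < ε)
    (hT : 1000 * (lam ^ 2 * Real.exp (12 * lam) * Real.log n / ε ^ 4) ≤ T)
    (hN : 1000 * (lam ^ 2 * Real.exp (12 * lam) * Real.log (n / ρ) / ε ^ 4) ≤ N) :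
    ENNReal.ofReal (1 - ρ) ≤
      isingSamples A θ N {z | ∀ i j, |A i j - isingEstimate lam T z i j| ≤ ε} := by
  have hn' : (2 : ℝ) ≤ n := by exact_mod_cast hn
  have hlogn : 0 < Real.log n := Real.log_pos (by linarith)
  have hlogρ : 0 < Real.log (n / ρ) := Real.log_pos (by
    rw [lt_div_iff₀ hρ]
    linarith)
  -- The scale at which both hypotheses become 1000 · log / q² ≤ T or N, so that both square roots
  -- are small multiples of q, while λq = ε² e^{-6λ}.
  set q := ε ^ 2 * Real.exp (-(6 * lam)) / lam with hq
  have hqpos : 0 < q := by positivity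
  have hscale : ∀ X : ℝ, lam ^ 2 * Real.exp (12 * lam) * X / ε ^ 4 = X / q ^ 2 := by
    intro X
    have : Real.exp (12 * lam) * Real.exp (-(6 * lam)) ^ 2 = 1 := by
      rw [← Real.exp_nat_mul, ← Real.exp_add]
      push_cast
      rw [show 12 * lam + 2 * -(6 * lam) = 0 by ring, Real.exp_zero]
    have hpos := Real.exp_pos (-(6 * lam))
    rw [hq]
    generalize Real.exp (12 * lam) = a at *
    generalize Real.exp (-(6 * lam)) = b at *
    field_simp
    linear_combination X * this
  rw [hscale] at hT hN
  have hT0 : 0 < T := by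
    have : (0 : ℝ) < T := lt_of_lt_of_le (by positivity) hT
    exact_mod_cast this
  have hN0' : (0 : ℝ) < N := lt_of_lt_of_le (by positivity) hN
  have hN0 : 0 < N := by exact_mod_cast hN0'
  set h := √(10 * Real.log (n / ρ) / N) with hh
  have hh0 : 0 ≤ h := Real.sqrt_nonneg _
  have hhle : h ≤ 1 / 10 * q :=
    sqrt_div_le_of_le hlogρ hqpos (by norm_num) (by norm_num) hN
  have hopt : √(2 * Real.log (2 * n + 1) / T) ≤ 2 / 25 * q := by
    refine le_trans (Real.sqrt_le_sqrt ?_)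
      (sqrt_div_le_of_le (a := 6) hlogn hqpos (by norm_num) (by norm_num) hT)
    refine div_le_div_of_nonneg_right ?_ (Nat.cast_nonneg T)
    have := log_two_mul_add_one_le hn
    linarith
  refine (pi_pmf_uniform_hoeffding (isingPMF A θ) (abs_sampleStatistic_le (A := A) (θ := θ))
    hN0 hh0 (card_mul_exp_le hn hρ hρ₁ hN0 (Real.sq_sqrt (by positivity)))).trans
    (measure_mono fun z hz i j => ?_)
  by_cases hij : j = i
  · subst hij
    simp [isingEstimate, hdiag, hε.le]
  have herr := isingEstimate_error hA hdiag hlam hlam₀ hT0 hh0 hz hij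
  -- From 1 + 2λ ≤ e^{2λ}; it makes the λ² error term linear in λ.
  have hlamexp : Real.exp (-(2 * lam)) * lam ≤ 1 / 2 := by
    have h₁ := Real.add_one_le_exp (2 * lam)
    have h₂ : Real.exp (-(2 * lam)) * Real.exp (2 * lam) = 1 := by
      rw [← Real.exp_add]
      simp
    nlinarith [Real.exp_pos (-(2 * lam))]
  have hlq : lam * q = ε ^ 2 * Real.exp (-(6 * lam)) := by
    rw [hq]
    field_simp
  have hexp : Real.exp (-(6 * lam)) ≤ Real.exp (-(4 * lam)) :=
    Real.exp_le_exp.2 (by linarith)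
  -- The three error terms are at most 1/5, 2/5 and 1/5 of λq, together less than λq ≤ ε² e^{-4λ}.
  have hfinal : Real.exp (-(4 * lam)) * (A i j - isingEstimate lam T z i j) ^ 2
      ≤ Real.exp (-(4 * lam)) * ε ^ 2 := by
    have e₁ : 5 / 2 * lam * √(2 * Real.log (2 * n + 1) / T) ≤ 5 / 2 * lam * (2 / 25 * q) :=
      mul_le_mul_of_nonneg_left hopt (by positivity)
    have e₂ : 4 * lam * h ≤ 4 * lam * (1 / 10 * q) :=
      mul_le_mul_of_nonneg_left hhle (by positivity)
    have e₃ : 4 * Real.exp (-(2 * lam)) * lam ^ 2 * h ≤ 2 * lam * (1 / 10 * q) := by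
      have : 4 * Real.exp (-(2 * lam)) * lam ^ 2 ≤ 2 * lam := by nlinarith
      exact mul_le_mul this hhle hh0 (by positivity)
    have e₄ : ε ^ 2 * Real.exp (-(6 * lam)) ≤ ε ^ 2 * Real.exp (-(4 * lam)) :=
      mul_le_mul_of_nonneg_left hexp (sq_nonneg ε)
    have e₅ : 0 < lam * q := by positivity
    linarith
  exact abs_le_of_sq_le_sq (le_of_mul_le_mul_left hfinal (Real.exp_pos _)) hε.le

theorem isingWidth_nonneg : 0 ≤ isingWidth A θ :=
  Real.iSup_nonneg fun _ => add_nonneg (Finset.sum_nonneg fun _ _ => abs_nonneg _)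
    (abs_nonneg _)

theorem abs_le_isingWidth (i j : Fin n) : |A i j| ≤ isingWidth A θ :=
  ((Finset.single_le_sum (f := fun j => |A i j|) (fun _ _ => abs_nonneg _)
    (Finset.mem_univ j)).trans (le_add_of_nonneg_right (abs_nonneg (θ i)))).trans
    (le_ciSup (f := fun i => (∑ j, |A i j|) + |θ i|) (Set.finite_range _).bddAbove i)

theorem isingEstimate_guarantee (hA : A.IsSymm) (hdiag : ∀ i, A i i = 0)
    (hlam : isingWidth A θ ≤ lam) (hρ : 0 < ρ) (hρ₁ : ρ < 1) (hε : 0 < ε)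
    (hT : 1000 * (lam ^ 2 * Real.exp (12 * lam) * Real.log n / ε ^ 4) ≤ T)
    (hN : 1000 * (lam ^ 2 * Real.exp (12 * lam) * Real.log (n / ρ) / ε ^ 4) ≤ N) :
    ENNReal.ofReal (1 - ρ) ≤
      isingSamples A θ N {z | ∀ i j, |A i j - isingEstimate lam T z i j| ≤ ε} := by
  -- For n ≤ 1 or λ = 0 the hypotheses do not force T or N to be positive. Then there are no
  -- off-diagonal entries, or A vanishes and the factor W = 0 makes the estimate vanish too.
  have htriv : (∀ (z : Fin N → Fin n → ℤˣ) (i j : Fin n), j ≠ i →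
      A i j - isingEstimate lam T z i j = 0) → ENNReal.ofReal (1 - ρ) ≤
      isingSamples A θ N {z | ∀ i j, |A i j - isingEstimate lam T z i j| ≤ ε} := by
    intro hzero
    have huniv : {z : Fin N → Fin n → ℤˣ | ∀ i j, |A i j - isingEstimate lam T z i j| ≤ ε}
        = Set.univ := by
      refine Set.eq_univ_of_forall fun z i j => ?_
      by_cases hij : j = i
      · subst hij
        simp [isingEstimate, hdiag, hε.le]
      · rw [hzero z i j hij, abs_zero]
        exact hε.le
    rw [huniv, isingSamples, measure_univ]
    exact ENNReal.ofReal_le_one.2 (by linarith)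
  rcases Nat.lt_or_ge n 2 with hn | hn
  · exact htriv fun z i j hij => absurd (Fin.ext (by omega)) hij
  rcases (isingWidth_nonneg.trans hlam).eq_or_lt with h0 | hpos
  · refine htriv fun z i j hij => ?_
    have hAij : A i j = 0 :=
      abs_nonpos_iff.1 ((abs_le_isingWidth (θ := θ) i j).trans (hlam.trans h0.ge))
    simp [isingEstimate, hij, mirrorDescent, ← h0, hAij]
  · exact isingEstimate_close hA hdiag hlam hpos hn hρ hρ₁ hε hT hN

end

/-! ### Running time at the stated sample size, and the theorem. -/

theorem steps_le_of_eq_ceil {lam ρ ε : ℝ} (hlam : 0 < lam) (hρ : 0 < ρ) (hρ₁ : ρ < 1)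
    (hε : 0 < ε) : ∃ B : ℝ, ∀ (n N T : ℕ) (eta : ℝ) (z : Fin N → Fin n → ℤˣ), 2 ≤ n →
      T = ⌈1000 * (lam ^ 2 * Real.exp (12 * lam) * Real.log n / ε ^ 4)⌉₊ →
      N = ⌈1000 * (lam ^ 2 * Real.exp (12 * lam) * Real.log (n / ρ) / ε ^ 4)⌉₊ →
      (IsingProgram.steps T lam eta z : ℝ) ≤ B * (n ^ 2 * Real.log n ^ 2) := by
  set c := 1000 * (lam ^ 2 * Real.exp (12 * lam) / ε ^ 4) with hc
  have hcpos : 0 < c := by positivity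
  have hρlog : Real.log ρ < 0 := Real.log_neg hρ hρ₁
  refine ⟨2000 * ((c + 2) * (c - 2 * c * Real.log ρ + 2)), fun n N T eta z hn hT hN => ?_⟩
  have hn' : (2 : ℝ) ≤ n := by exact_mod_cast hn
  -- This absorbs the constants into ln n: the rounding 1 is at most 2 ln n, and -c ln ρ is at most
  -- -2c ln ρ · ln n.
  have hlog : 1 / 2 ≤ Real.log n := by
    have := Real.log_le_log (by norm_num) hn'
    have := Real.log_two_gt_d9
    linarith
  have hdiv : Real.log (n / ρ) = Real.log n - Real.log ρ :=
    Real.log_div (by linarith) hρ.ne'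
  have hscale : ∀ X : ℝ, 1000 * (lam ^ 2 * Real.exp (12 * lam) * X / ε ^ 4) = c * X := by
    intro X
    rw [hc]
    ring
  rw [hscale] at hT hN
  rw [hdiv] at hN
  have hXT : 0 < c * Real.log n := by positivity
  have hXN : 0 < c * (Real.log n - Real.log ρ) := mul_pos hcpos (by linarith)
  have hT1 : 1 ≤ T := by
    rw [hT]
    exact Nat.ceil_pos.2 hXT
  have hN1 : 1 ≤ N := by
    rw [hN]
    exact Nat.ceil_pos.2 hXN
  have hTle : (T : ℝ) ≤ (c + 2) * Real.log n := by
    have := (Nat.ceil_lt_add_one hXT.le).le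
    rw [← hT] at this
    linarith
  have hNle : (N : ℝ) ≤ (c - 2 * c * Real.log ρ + 2) * Real.log n := by
    have := (Nat.ceil_lt_add_one hXN.le).le
    rw [← hN] at this
    have h2 : 0 ≤ c * -Real.log ρ * (2 * Real.log n - 1) :=
      mul_nonneg (mul_nonneg hcpos.le (by linarith)) (by linarith)
    linarith
  have hsteps : (IsingProgram.steps T lam eta z : ℝ) ≤ 2000 * (T * N * n ^ 2) := by
    exact_mod_cast IsingProgram.steps_le lam eta z (by omega) hN1 hT1
  calc _ ≤ 2000 * ((T : ℝ) * N * n ^ 2) := hsteps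
    _ ≤ 2000 * (((c + 2) * Real.log n) * ((c - 2 * c * Real.log ρ + 2) * Real.log n)
        * n ^ 2) := by gcongr
    _ = _ := by ring

theorem mainTheorem5 :
    ∃ C : ℝ, 0 < C ∧
      -- statistical guarantee
      (∀ (n : ℕ) (A : Matrix (Fin n) (Fin n) ℝ) (θ : Fin n → ℝ) (lam ρ ε : ℝ) (N T : ℕ),
        A.IsSymm → (∀ i, A i i = 0) → isingWidth A θ ≤ lam →
        0 < ρ → ρ < 1 → 0 < ε →
        C * (lam ^ 2 * Real.exp (12 * lam) * Real.log n / ε ^ 4) ≤ T →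
        C * (lam ^ 2 * Real.exp (12 * lam) * Real.log (n / ρ) / ε ^ 4) ≤ N →
        ENNReal.ofReal (1 - ρ) ≤
          isingSamples A θ N {z | ∀ i j, |A i j - isingEstimate lam T z i j| ≤ ε}) ∧
      -- the program computes the estimates
      (∀ (n N T : ℕ) (lam eta : ℝ) (z : Fin N → Fin n → ℤˣ),
        (∀ i j : Fin n, (IsingProgram.output T lam eta z).arr .Ahat (i * n + j)
          = isingEstimate lam T z i j) ∧
        (∀ i j : Fin n,
          ((isingGraphEstimate lam eta T z).Adj i j →
            (IsingProgram.output T lam eta z).arr .edge (i * n + j) = 1) ∧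
          (¬ (isingGraphEstimate lam eta T z).Adj i j →
            (IsingProgram.output T lam eta z).arr .edge (i * n + j) = 0))) ∧
      -- its running time is `O(T N n²)`
      (∃ K : ℝ, ∀ (n N T : ℕ) (lam eta : ℝ) (z : Fin N → Fin n → ℤˣ),
        1 ≤ n → 1 ≤ N → 1 ≤ T →
        (IsingProgram.steps T lam eta z : ℝ) ≤ K * (T * N * n ^ 2)) ∧
      -- which is `O(n² (ln n)²)` for the stated numbers of iterations and samples
      (∀ lam ρ ε : ℝ, 0 < lam → 0 < ρ → ρ < 1 → 0 < ε →
        ∃ B : ℝ, ∀ (n N T : ℕ) (eta : ℝ) (z : Fin N → Fin n → ℤˣ), 2 ≤ n →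
          T = ⌈C * (lam ^ 2 * Real.exp (12 * lam) * Real.log n / ε ^ 4)⌉₊ →
          N = ⌈C * (lam ^ 2 * Real.exp (12 * lam) * Real.log (n / ρ) / ε ^ 4)⌉₊ →
          (IsingProgram.steps T lam eta z : ℝ) ≤ B * (n ^ 2 * Real.log n ^ 2)) := by
  refine ⟨1000, by norm_num, ?_, ?_, ⟨2000, ?_⟩, ?_⟩
  · intro n A θ lam ρ ε N T hA hdiag hlam hρ hρ₁ hε hT hN
    exact isingEstimate_guarantee hA hdiag hlam hρ hρ₁ hε hT hN
  · intro n N T lam eta z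
    refine ⟨fun i j => (IsingProgram.output_correct i j).1, fun i j => ⟨fun h => ?_, fun h => ?_⟩⟩
    · rw [(IsingProgram.output_correct i j).2, IsingProgram.edgeValue, if_pos h]
    · rw [(IsingProgram.output_correct i j).2, IsingProgram.edgeValue, if_neg h]
  · intro n N T lam eta z hn hN hT
    exact_mod_cast IsingProgram.steps_le lam eta z hn hN hT
  · intro lam ρ ε hlam hρ hρ₁ hε
    exact steps_le_of_eq_ceil hlam hρ hρ₁ hε
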